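/- **Setting.** Let $\mathscr C$ be an additive category and $\mathbb E:\mathscr C^{\mathrm{op}}\times\mathscr C\to\mathrm{Ab}$ a biadditive functor. For $\delta\in\mathbb E(C,A)$, $a:A\to A'$, $c:C'\to C$ write $a_*\delta=\mathbb E(C,a)(\delta)$ and $c^*\delta=\mathbb E(c,A)(\delta)$. A morphism $(a,c):\delta\to\delta'$ from $\delta\in\mathbb E(C,A)$ to $\delta'\in\mathbb E(C',A')$ is a pair $a:A\to A'$, $c:C\to C'$ with $a_*\delta=c^*\delta'$. Write $\delta\oplus\delta'\in\mathbb E(C\oplus C',A\oplus A')$ for the element corresponding to $(\delta,0,0,\delta')$. Two sequences $A\to B\to C$ and $A\to B'\to C$ are equivalent if there is an isomorphism $B\cong B'$ compatible with the identities of $A$ and $C$; $[A\to B\to C]$ denotes the equivalence class. Let $\mathfrak s$ assign to every $\delta\in\mathbb E(C,A)$ a class $\mathfrak s(\delta)=[A\xrightarrow{x}B\xrightarrow{y}C]$; then $A\xrightarrow{x}B\xrightarrow{y}C\overset{\delta}{\dashrightarrow}$ is called an *$\mathbb E$-triangle*, $x$ an *inflation* and $y$ a *deflation*. A *morphism* from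 this $\mathbb E$-triangle to $A'\xrightarrow{x'}B'\xrightarrow{y'}C'\overset{\delta'}{\dashrightarrow}$ is a triple $(a,b,c)$ with $bx=x'a$, $cy=y'b$ and $a_*\delta=c^*\delta'$. The triple $(\mathscr C,\mathbb E,\mathfrak s)$ is *pre-extriangulated* if * for $\mathbb E$-triangles as above, every morphism $(a,c):\delta\to\delta'$ extends to a morphism $(a,b,c)$ of $\mathbb E$-triangles; * $\mathfrak s(0)=[A\xrightarrow{\binom10}A\oplus C\xrightarrow{(0,1)}C]$ for $0\in\mathbb E(C,A)$, and $\mathfrak s(\delta\oplus\delta')=\mathfrak s(\delta)\oplus\mathfrak s(\delta')$ for all $\delta,\delta'$; * (ET3) for $\mathbb E$-triangles as above, any $(a,b)$ with $bx=x'a$ extends to a morphism $(a,b,c)$ of $\mathbb E$-triangles; * (ET3)$^{\mathrm{op}}$ any $(b,c)$ with $cy=y'b$ extends to a morphism $(a,b,c)$ of $\mathbb E$-triangles. The opposite category $\mathscr C^{\mathrm{op}}$ is then pre-extriangulated, with $\mathbb E^{\mathrm{op}}(C,A)=\mathbb E(A,C)$ and with the reversed $\mathbb E$-triangles. A commutative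 square with $x:A\to B$, $f:A\to C$, $g:B\to D$, $y:C\to D$, $gx=yf$, is *homotopy cartesian with differential $\partial$* if $A\xrightarrow{\binom{-f}{x}}C\oplus B\xrightarrow{(y,g)}D\overset{\partial}{\dashrightarrow}$ is an $\mathbb E$-triangle. **Conditions.** * (ET0) The composite of two composable inflations is an inflation. (ET0)$^{\mathrm{op}}$ The composite of two composable deflations is a deflation. * (ET4) For all $\mathbb E$-triangles $A\xrightarrow{f}B\xrightarrow{f'}D\overset{\delta}{\dashrightarrow}$ and $B\xrightarrow{g}C\xrightarrow{g'}F\overset{\delta'}{\dashrightarrow}$ there are $\mathbb E$-triangles $A\xrightarrow{h}C\xrightarrow{h'}E\overset{\delta''}{\dashrightarrow}$ and $D\xrightarrow{d}E\xrightarrow{e}F\overset{f'_*\delta'}{\dashrightarrow}$ with $h=gf$, $df'=h'g$, $eh'=g'$, $d^*\delta''=\delta$ and $f_*\delta''=e^*\delta'$. * (ET4-1) For all $\mathbb E$-triangles $A_i\xrightarrow{x_i}B_i\xrightarrow{y_i}C\overset{\delta_i}{\dashrightarrow}$ ($i=1,2$) there are $\mathbb E$-triangles $A_1\xrightarrow{m_1}M\xrightarrow{e_1}B_2\overset{y_2^*\delta_1}{\dashrightarrow}$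 and $A_2\xrightarrow{m_2}M\xrightarrow{e_2}B_1\overset{y_1^*\delta_2}{\dashrightarrow}$ with $e_1m_2=x_2$, $e_2m_1=x_1$, $y_2e_1=y_1e_2$ and $m_{1*}\delta_1+m_{2*}\delta_2=0$. * (ET4-2) For every $\mathbb E$-triangle $A\xrightarrow{x}B\xrightarrow{y}C\overset{\delta}{\dashrightarrow}$, every $f:A\to D$ and every $\mathbb E$-triangle $D\xrightarrow{d}E\xrightarrow{e}C\overset{f_*\delta}{\dashrightarrow}$ there is $g:B\to E$ such that $(f,g,\mathrm{id}_C)$ is a morphism of $\mathbb E$-triangles and $A\xrightarrow{\binom{-f}{x}}D\oplus B\xrightarrow{(d,g)}E\overset{e^*\delta}{\dashrightarrow}$ is an $\mathbb E$-triangle. * (ET4-3) For all $\mathbb E$-triangles $A\xrightarrow{f}B\xrightarrow{f'}D\overset{\delta_f}{\dashrightarrow}$, $B\xrightarrow{g}C\xrightarrow{g'}F\overset{\delta_g}{\dashrightarrow}$ and $A\xrightarrow{h}C\xrightarrow{h_0}E_0\overset{\delta_h}{\dashrightarrow}$ with $h=gf$ there is an $\mathbb E$-triangle $D\xrightarrow{d_0}E_0\xrightarrow{e_0}F\overset{f'_*\delta_g}{\dashrightarrow}$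 with $d_0f'=h_0g$, $e_0h_0=g'$, $d_0^*\delta_h=\delta_f$ and $f_*\delta_h=e_0^*\delta_g$. * (ET4-4) For all $\mathbb E$-triangles $D\xrightarrow{f}A\xrightarrow{f'}C\overset{\delta_f}{\dashrightarrow}$, $A\xrightarrow{g}B\xrightarrow{g'}F\overset{\delta_g}{\dashrightarrow}$ and $E\xrightarrow{h}B\xrightarrow{h'}C\overset{\delta_h}{\dashrightarrow}$ with $h'g=f'$ there is an $\mathbb E$-triangle $D\xrightarrow{d}E\xrightarrow{e}F\overset{\theta}{\dashrightarrow}$ with $gf=hd$, $g'h=e$, $d_*\delta_f=\delta_h$, $f_*\theta=\delta_g$ and $g'^*\theta+h'^*\delta_f=0$. * (ET4-5) For all $\mathbb E$-triangles $A_1\xrightarrow{x_1}B_1\xrightarrow{y_1}C\overset{\delta}{\dashrightarrow}$ and $A_2\xrightarrow{x_2}B_2\xrightarrow{y_2}C\overset{\delta'}{\dashrightarrow}$ and every $g:B_1\to B_2$ with $y_2g=y_1$ there is $f:A_1\to A_2$ such that $(f,g,\mathrm{id}_C)$ is a morphism of $\mathbb E$-triangles and the square formed by $x_1,f,g,x_2$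 is homotopy cartesian with differential $y_2^*\delta$. **Theorem.** Let $(\mathscr C,\mathbb E,\mathfrak s)$ be a pre-extriangulated category which satisfies (ET0) and (ET0)$^{\mathrm{op}}$. Then the conditions (ET4), (ET4-1), (ET4-2), (ET4-3), (ET4-4) and (ET4-5) on $\mathscr C$ are equivalent. Moreover each of them is self-dual: $\mathscr C$ satisfies the condition if and only if $\mathscr C^{\mathrm{op}}$ satisfies it. -/

import Mathlib

open CategoryTheory CategoryTheory.Limits Opposite
open scoped ZeroObject

universe w v u

/-- A sequence `A ⟶ B ⟶ C` with prescribed end terms. -/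
structure ESeq {𝒞 : Type u} [Category.{v} 𝒞] (A C : 𝒞) where
  mid : 𝒞
  fst : A ⟶ mid
  snd : mid ⟶ C

namespace ESeq

/-- Two sequences with the same end terms are equivalent if there is an isomorphism of the middle
terms which is compatible with the identities of the end terms. -/
def Equivalent {𝒞 : Type u} [Category.{v} 𝒞] {A C : 𝒞} (S T : ESeq A C) : Prop :=
  ∃ b : S.mid ≅ T.mid, S.fst ≫ b.hom = T.fst ∧ b.hom ≫ T.snd = S.snd

instance setoid {𝒞 : Type u} [Category.{v} 𝒞] (A C : 𝒞) : Setoid (ESeq A C) where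
  r := Equivalent
  iseqv :=
    { refl := fun S => ⟨Iso.refl _, by simp, by simp⟩
      symm := by
        rintro S T ⟨b, h₁, h₂⟩
        exact ⟨b.symm, by simp [← h₁], by simp [← h₂]⟩
      trans := by
        rintro S T U ⟨b, h₁, h₂⟩ ⟨b', h₁', h₂'⟩
        refine ⟨b ≪≫ b', ?_, ?_⟩
        · rw [Iso.trans_hom, ← Category.assoc, h₁, h₁']
        · rw [Iso.trans_hom, Category.assoc, h₂', h₂] }

/-- The sequence `C ⟶ B ⟶ A` in the opposite category given by a sequence `A ⟶ B ⟶ C`. -/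
def opposite {𝒞 : Type u} [Category.{v} 𝒞] {A C : 𝒞} (S : ESeq A C) : ESeq (op C) (op A) where
  mid := op S.mid
  fst := S.snd.op
  snd := S.fst.op

theorem opposite_equiv {𝒞 : Type u} [Category.{v} 𝒞] {A C : 𝒞} (S T : ESeq A C) (h : S ≈ T) :
    S.opposite ≈ T.opposite := by
  obtain ⟨b, h₁, h₂⟩ := h
  refine ⟨b.symm.op, ?_, ?_⟩
  · exact Quiver.Hom.unop_inj (by simp [opposite, ← h₂])
  · exact Quiver.Hom.unop_inj (by simp [opposite, ← h₁])

theorem equiv_of_opposite {𝒞 : Type u} [Category.{v} 𝒞] {A C : 𝒞} (S T : ESeq A C)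
    (h : S.opposite ≈ T.opposite) : S ≈ T := by
  obtain ⟨b, h₁, h₂⟩ := h
  exact ⟨b.symm.unop, congrArg Quiver.Hom.unop ((Iso.inv_comp_eq b).2 h₂.symm),
    congrArg Quiver.Hom.unop ((Iso.comp_inv_eq b).2 h₁.symm)⟩

end ESeq

/-- The group `𝔼(C, A)` of `𝔼`-extensions of `C` by `A`. -/
abbrev EExt {𝒞 : Type u} [Category.{v} 𝒞] (E : 𝒞ᵒᵖ ⥤ 𝒞 ⥤ AddCommGrpCat.{w}) (C A : 𝒞) : Type w :=
  ((E.obj (op C)).obj A : Type w)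

namespace EExt

/-- `a_* δ = 𝔼(C, a)(δ)`. -/
def push {𝒞 : Type u} [Category.{v} 𝒞] {E : 𝒞ᵒᵖ ⥤ 𝒞 ⥤ AddCommGrpCat.{w}} {C A A' : 𝒞}
    (a : A ⟶ A') (δ : EExt E C A) : EExt E C A' :=
  (E.obj (op C)).map a δ

/-- `c^* δ = 𝔼(c, A)(δ)`. -/
def pull {𝒞 : Type u} [Category.{v} 𝒞] {E : 𝒞ᵒᵖ ⥤ 𝒞 ⥤ AddCommGrpCat.{w}} {C C' A : 𝒞}
    (c : C' ⟶ C) (δ : EExt E C A) : EExt E C' A :=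
  (E.map c.op).app A δ

/-- `(a, c) : δ ⟶ δ'` is a morphism of `𝔼`-extensions: `a_* δ = c^* δ'`. -/
def IsMorphism {𝒞 : Type u} [Category.{v} 𝒞] {E : 𝒞ᵒᵖ ⥤ 𝒞 ⥤ AddCommGrpCat.{w}} {A A' C C' : 𝒞}
    (δ : EExt E C A) (δ' : EExt E C' A') (a : A ⟶ A') (c : C ⟶ C') : Prop :=
  push a δ = pull c δ'

/-- `δ ⊕ δ'`, the element of `𝔼(C ⊕ C', A ⊕ A')` which corresponds to `(δ, 0, 0, δ')` under
`𝔼(C ⊕ C', A ⊕ A') ≅ 𝔼(C, A) ⊕ 𝔼(C, A') ⊕ 𝔼(C', A) ⊕ 𝔼(C', A')`: the inverse of this isomorphism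
sends an element of a summand to its pull-back along the projection of `C ⊕ C'`, pushed out along
the inclusion into `A ⊕ A'`. -/
noncomputable def sum {𝒞 : Type u} [Category.{v} 𝒞] [Preadditive 𝒞] [HasBinaryBiproducts 𝒞]
    {E : 𝒞ᵒᵖ ⥤ 𝒞 ⥤ AddCommGrpCat.{w}} {A A' C C' : 𝒞} (δ : EExt E C A) (δ' : EExt E C' A') :
    EExt E (C ⊞ C') (A ⊞ A') :=
  push biprod.inl (pull biprod.fst δ) + push biprod.inr (pull biprod.snd δ')

theorem push_pull {𝒞 : Type u} [Category.{v} 𝒞] {E : 𝒞ᵒᵖ ⥤ 𝒞 ⥤ AddCommGrpCat.{w}} {C C' A A' : 𝒞}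
    (a : A ⟶ A') (c : C' ⟶ C) (δ : EExt E C A) : push a (pull c δ) = pull c (push a δ) :=
  (NatTrans.naturality_apply (E.map c.op) a δ).symm

theorem push_push {𝒞 : Type u} [Category.{v} 𝒞] {E : 𝒞ᵒᵖ ⥤ 𝒞 ⥤ AddCommGrpCat.{w}}
    {C A A' A'' : 𝒞} (a : A ⟶ A') (a' : A' ⟶ A'') (δ : EExt E C A) :
    push a' (push a δ) = push (a ≫ a') δ := by
  simp [push]

theorem pull_pull {𝒞 : Type u} [Category.{v} 𝒞] {E : 𝒞ᵒᵖ ⥤ 𝒞 ⥤ AddCommGrpCat.{w}}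
    {C C' C'' A : 𝒞} (c : C' ⟶ C) (c' : C'' ⟶ C') (δ : EExt E C A) :
    pull c' (pull c δ) = pull (c' ≫ c) δ := by
  simp [pull]

theorem push_id {𝒞 : Type u} [Category.{v} 𝒞] {E : 𝒞ᵒᵖ ⥤ 𝒞 ⥤ AddCommGrpCat.{w}} {C A : 𝒞}
    (δ : EExt E C A) : push (𝟙 A) δ = δ := by
  simp [push]

theorem pull_id {𝒞 : Type u} [Category.{v} 𝒞] {E : 𝒞ᵒᵖ ⥤ 𝒞 ⥤ AddCommGrpCat.{w}} {C A : 𝒞}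
    (δ : EExt E C A) : pull (𝟙 C) δ = δ := by
  simp [pull]

theorem push_add {𝒞 : Type u} [Category.{v} 𝒞] {E : 𝒞ᵒᵖ ⥤ 𝒞 ⥤ AddCommGrpCat.{w}} {C A A' : 𝒞}
    (a : A ⟶ A') (δ δ' : EExt E C A) : push a (δ + δ') = push a δ + push a δ' := by
  simp [push]

theorem pull_add {𝒞 : Type u} [Category.{v} 𝒞] {E : 𝒞ᵒᵖ ⥤ 𝒞 ⥤ AddCommGrpCat.{w}} {C C' A : 𝒞}
    (c : C' ⟶ C) (δ δ' : EExt E C A) : pull c (δ + δ') = pull c δ + pull c δ' := by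
  simp [pull]

theorem push_pull_sum {𝒞 : Type u} [Category.{v} 𝒞] [Preadditive 𝒞] [HasBinaryBiproducts 𝒞]
    {E : 𝒞ᵒᵖ ⥤ 𝒞 ⥤ AddCommGrpCat.{w}} {A A' A'' C C' C'' : 𝒞} (δ : EExt E C A) (δ' : EExt E C' A')
    (a : A ⊞ A' ⟶ A'') (c : C'' ⟶ C ⊞ C') :
    push a (pull c (sum δ δ')) = pull (c ≫ biprod.fst) (push (biprod.inl ≫ a) δ) +
      pull (c ≫ biprod.snd) (push (biprod.inr ≫ a) δ') := by
  simp only [sum, pull_add, push_add, push_pull, push_push, pull_pull]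

end EExt

/-- A pre-extriangulated structure `(𝔼, 𝔰)` on the additive category `𝒞`. -/
structure PreExtriangulated (𝒞 : Type u) [Category.{v} 𝒞] [Preadditive 𝒞] [HasZeroObject 𝒞]
    [HasBinaryBiproducts 𝒞] where
  /-- the bifunctor `𝔼 : 𝒞ᵒᵖ × 𝒞 ⥤ Ab`, in curried form -/
  E : 𝒞ᵒᵖ ⥤ 𝒞 ⥤ AddCommGrpCat.{w}
  /-- (ET1), additivity in the first variable -/
  additive_fst : E.Additive
  /-- (ET1), additivity in the second variable -/
  additive_snd : ∀ C : 𝒞ᵒᵖ, (E.obj C).Additive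
  /-- the correspondence `𝔰`, which sends an extension to an equivalence class of sequences -/
  s : ∀ {A C : 𝒞}, EExt E C A → Quotient (ESeq.setoid A C)
  /-- (ET2), `𝔰` is a realization -/
  realization : ∀ {A B C A' B' C' : 𝒞} (x : A ⟶ B) (y : B ⟶ C) (δ : EExt E C A)
    (x' : A' ⟶ B') (y' : B' ⟶ C') (δ' : EExt E C' A') (a : A ⟶ A') (c : C ⟶ C'),
    s δ = Quotient.mk _ ⟨B, x, y⟩ → s δ' = Quotient.mk _ ⟨B', x', y'⟩ →
    EExt.IsMorphism δ δ' a c → ∃ b : B ⟶ B', x ≫ b = a ≫ x' ∧ y ≫ c = b ≫ y'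
  /-- (ET2), `𝔰(0) = 0` -/
  realization_zero : ∀ A C : 𝒞,
    s (0 : EExt E C A) = Quotient.mk _ ⟨A ⊞ C, biprod.inl, biprod.snd⟩
  /-- (ET2), `𝔰(δ ⊕ δ') = 𝔰(δ) ⊕ 𝔰(δ')` -/
  realization_sum : ∀ {A B C A' B' C' : 𝒞} (x : A ⟶ B) (y : B ⟶ C) (δ : EExt E C A)
    (x' : A' ⟶ B') (y' : B' ⟶ C') (δ' : EExt E C' A'),
    s δ = Quotient.mk _ ⟨B, x, y⟩ → s δ' = Quotient.mk _ ⟨B', x', y'⟩ →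
    s (EExt.sum δ δ') = Quotient.mk _ ⟨B ⊞ B', biprod.map x x', biprod.map y y'⟩
  /-- (ET3) -/
  et3 : ∀ {A B C A' B' C' : 𝒞} (x : A ⟶ B) (y : B ⟶ C) (δ : EExt E C A)
    (x' : A' ⟶ B') (y' : B' ⟶ C') (δ' : EExt E C' A') (a : A ⟶ A') (b : B ⟶ B'),
    s δ = Quotient.mk _ ⟨B, x, y⟩ → s δ' = Quotient.mk _ ⟨B', x', y'⟩ →
    x ≫ b = a ≫ x' → ∃ c : C ⟶ C', y ≫ c = b ≫ y' ∧ EExt.IsMorphism δ δ' a c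
  /-- (ET3)ᵒᵖ -/
  et3op : ∀ {A B C A' B' C' : 𝒞} (x : A ⟶ B) (y : B ⟶ C) (δ : EExt E C A)
    (x' : A' ⟶ B') (y' : B' ⟶ C') (δ' : EExt E C' A') (b : B ⟶ B') (c : C ⟶ C'),
    s δ = Quotient.mk _ ⟨B, x, y⟩ → s δ' = Quotient.mk _ ⟨B', x', y'⟩ →
    y ≫ c = b ≫ y' → ∃ a : A ⟶ A', x ≫ b = a ≫ x' ∧ EExt.IsMorphism δ δ' a c

namespace PreExtriangulated

/-- The maps `x : A ⟶ B`, `y : B ⟶ C` and the extension `δ` form an `𝔼`-triangle: the sequence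
`(x, y)` realizes `δ`. -/
def IsTriangle {𝒞 : Type u} [Category.{v} 𝒞] [Preadditive 𝒞] [HasZeroObject 𝒞]
    [HasBinaryBiproducts 𝒞] (P : PreExtriangulated.{w} 𝒞) {A B C : 𝒞} (x : A ⟶ B) (y : B ⟶ C)
    (δ : EExt P.E C A) : Prop :=
  P.s δ = Quotient.mk _ ⟨B, x, y⟩

/-- `(a, b, c)` is a morphism between the `𝔼`-triangles `(x, y, δ)` and `(x', y', δ')`. -/
structure IsTriangleMorphism {𝒞 : Type u} [Category.{v} 𝒞] [Preadditive 𝒞] [HasZeroObject 𝒞]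
    [HasBinaryBiproducts 𝒞] (P : PreExtriangulated.{w} 𝒞) {A B C A' B' C' : 𝒞}
    (x : A ⟶ B) (y : B ⟶ C) (δ : EExt P.E C A) (x' : A' ⟶ B') (y' : B' ⟶ C') (δ' : EExt P.E C' A')
    (a : A ⟶ A') (b : B ⟶ B') (c : C ⟶ C') : Prop where
  source : P.IsTriangle x y δ
  target : P.IsTriangle x' y' δ'
  comm_left : x ≫ b = a ≫ x'
  comm_right : y ≫ c = b ≫ y'
  ext : EExt.IsMorphism δ δ' a c

/-- `f` is the first morphism of some `𝔼`-triangle. -/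
def Inflation {𝒞 : Type u} [Category.{v} 𝒞] [Preadditive 𝒞] [HasZeroObject 𝒞]
    [HasBinaryBiproducts 𝒞] (P : PreExtriangulated.{w} 𝒞) {A B : 𝒞} (f : A ⟶ B) : Prop :=
  ∃ (C : 𝒞) (y : B ⟶ C) (δ : EExt P.E C A), P.IsTriangle f y δ

/-- `f` is the second morphism of some `𝔼`-triangle. -/
def Deflation {𝒞 : Type u} [Category.{v} 𝒞] [Preadditive 𝒞] [HasZeroObject 𝒞]
    [HasBinaryBiproducts 𝒞] (P : PreExtriangulated.{w} 𝒞) {B C : 𝒞} (f : B ⟶ C) : Prop :=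
  ∃ (A : 𝒞) (x : A ⟶ B) (δ : EExt P.E C A), P.IsTriangle x f δ

/-- The square
```
A --x--> B
|f       |g
v        v
C --y--> D
```
commutes and is homotopy cartesian with differential `δ`. -/
def HomotopyCartesian {𝒞 : Type u} [Category.{v} 𝒞] [Preadditive 𝒞] [HasZeroObject 𝒞]
    [HasBinaryBiproducts 𝒞] (P : PreExtriangulated.{w} 𝒞) {A B C D : 𝒞}
    (x : A ⟶ B) (f : A ⟶ C) (g : B ⟶ D) (y : C ⟶ D) (δ : EExt P.E D A) : Prop :=
  x ≫ g = f ≫ y ∧ P.IsTriangle (biprod.lift (-f) x) (biprod.desc y g) δ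

/-- (ET0): inflations are closed under composition. -/
def ET0 {𝒞 : Type u} [Category.{v} 𝒞] [Preadditive 𝒞] [HasZeroObject 𝒞]
    [HasBinaryBiproducts 𝒞] (P : PreExtriangulated.{w} 𝒞) : Prop :=
  ∀ ⦃A B C : 𝒞⦄ (f : A ⟶ B) (g : B ⟶ C), P.Inflation f → P.Inflation g → P.Inflation (f ≫ g)

/-- (ET0)ᵒᵖ: deflations are closed under composition. -/
def ET0op {𝒞 : Type u} [Category.{v} 𝒞] [Preadditive 𝒞] [HasZeroObject 𝒞]
    [HasBinaryBiproducts 𝒞] (P : PreExtriangulated.{w} 𝒞) : Prop :=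
  ∀ ⦃A B C : 𝒞⦄ (f : A ⟶ B) (g : B ⟶ C), P.Deflation f → P.Deflation g → P.Deflation (f ≫ g)

/-- (ET4) -/
def ET4 {𝒞 : Type u} [Category.{v} 𝒞] [Preadditive 𝒞] [HasZeroObject 𝒞]
    [HasBinaryBiproducts 𝒞] (P : PreExtriangulated.{w} 𝒞) : Prop :=
  ∀ ⦃A B C D F : 𝒞⦄ (f : A ⟶ B) (f' : B ⟶ D) (δ : EExt P.E D A)
    (g : B ⟶ C) (g' : C ⟶ F) (δ' : EExt P.E F B),
    P.IsTriangle f f' δ → P.IsTriangle g g' δ' →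
    ∃ (E : 𝒞) (h : A ⟶ C) (h' : C ⟶ E) (δ'' : EExt P.E E A) (d : D ⟶ E) (e : E ⟶ F),
      f ≫ g = h ∧ f' ≫ d = g ≫ h' ∧ h' ≫ e = g' ∧
      P.IsTriangle h h' δ'' ∧ P.IsTriangle d e (EExt.push f' δ') ∧
      EExt.pull d δ'' = δ ∧ EExt.push f δ'' = EExt.pull e δ'

/-- (ET4)ᵒᵖ -/
def ET4op {𝒞 : Type u} [Category.{v} 𝒞] [Preadditive 𝒞] [HasZeroObject 𝒞]
    [HasBinaryBiproducts 𝒞] (P : PreExtriangulated.{w} 𝒞) : Prop :=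
  ∀ ⦃A B C D F : 𝒞⦄ (f' : D ⟶ A) (f : A ⟶ B) (δ : EExt P.E B D)
    (g' : F ⟶ B) (g : B ⟶ C) (δ' : EExt P.E C F),
    P.IsTriangle f' f δ → P.IsTriangle g' g δ' →
    ∃ (E : 𝒞) (h' : E ⟶ A) (h : A ⟶ C) (δ'' : EExt P.E C E) (d : D ⟶ E) (e : E ⟶ F),
      d ≫ h' = f' ∧ h' ≫ f = e ≫ g' ∧ f ≫ g = h ∧
      P.IsTriangle d e (EExt.pull g' δ) ∧ P.IsTriangle h' h δ'' ∧
      δ' = EExt.push e δ'' ∧ EExt.push d δ = EExt.pull g δ''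

/-- (ET4-1) -/
def ET4_1 {𝒞 : Type u} [Category.{v} 𝒞] [Preadditive 𝒞] [HasZeroObject 𝒞]
    [HasBinaryBiproducts 𝒞] (P : PreExtriangulated.{w} 𝒞) : Prop :=
  ∀ ⦃A₁ B₁ A₂ B₂ C : 𝒞⦄ (x₁ : A₁ ⟶ B₁) (y₁ : B₁ ⟶ C) (δ₁ : EExt P.E C A₁)
    (x₂ : A₂ ⟶ B₂) (y₂ : B₂ ⟶ C) (δ₂ : EExt P.E C A₂),
    P.IsTriangle x₁ y₁ δ₁ → P.IsTriangle x₂ y₂ δ₂ →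
    ∃ (M : 𝒞) (m₁ : A₁ ⟶ M) (e₁ : M ⟶ B₂) (m₂ : A₂ ⟶ M) (e₂ : M ⟶ B₁),
      m₂ ≫ e₁ = x₂ ∧ m₁ ≫ e₂ = x₁ ∧ e₁ ≫ y₂ = e₂ ≫ y₁ ∧
      P.IsTriangle m₁ e₁ (EExt.pull y₂ δ₁) ∧ P.IsTriangle m₂ e₂ (EExt.pull y₁ δ₂) ∧
      EExt.push m₁ δ₁ + EExt.push m₂ δ₂ = 0

/-- (ET4-2) -/
def ET4_2 {𝒞 : Type u} [Category.{v} 𝒞] [Preadditive 𝒞] [HasZeroObject 𝒞]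
    [HasBinaryBiproducts 𝒞] (P : PreExtriangulated.{w} 𝒞) : Prop :=
  ∀ ⦃A B C D E : 𝒞⦄ (x : A ⟶ B) (y : B ⟶ C) (δ : EExt P.E C A) (f : A ⟶ D)
    (d : D ⟶ E) (e : E ⟶ C),
    P.IsTriangle x y δ → P.IsTriangle d e (EExt.push f δ) →
    ∃ g : B ⟶ E, P.IsTriangleMorphism x y δ d e (EExt.push f δ) f g (𝟙 C) ∧
      P.IsTriangle (biprod.lift (-f) x) (biprod.desc d g) (EExt.pull e δ)

/-- (ET4-3) -/
def ET4_3 {𝒞 : Type u} [Category.{v} 𝒞] [Preadditive 𝒞] [HasZeroObject 𝒞]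
    [HasBinaryBiproducts 𝒞] (P : PreExtriangulated.{w} 𝒞) : Prop :=
  ∀ ⦃A B C D E F : 𝒞⦄ (f : A ⟶ B) (f' : B ⟶ D) (δf : EExt P.E D A)
    (g : B ⟶ C) (g' : C ⟶ F) (δg : EExt P.E F B)
    (h : A ⟶ C) (h₀ : C ⟶ E) (δh : EExt P.E E A),
    P.IsTriangle f f' δf → P.IsTriangle g g' δg → P.IsTriangle h h₀ δh → h = f ≫ g →
    ∃ (d₀ : D ⟶ E) (e₀ : E ⟶ F),
      f' ≫ d₀ = g ≫ h₀ ∧ h₀ ≫ e₀ = g' ∧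
      P.IsTriangle d₀ e₀ (EExt.push f' δg) ∧
      EExt.pull d₀ δh = δf ∧ EExt.push f δh = EExt.pull e₀ δg

/-- (ET4-4) -/
def ET4_4 {𝒞 : Type u} [Category.{v} 𝒞] [Preadditive 𝒞] [HasZeroObject 𝒞]
    [HasBinaryBiproducts 𝒞] (P : PreExtriangulated.{w} 𝒞) : Prop :=
  ∀ ⦃A B C D E F : 𝒞⦄ (f : D ⟶ A) (f' : A ⟶ C) (δf : EExt P.E C D)
    (g : A ⟶ B) (g' : B ⟶ F) (δg : EExt P.E F A)
    (h : E ⟶ B) (h' : B ⟶ C) (δh : EExt P.E C E),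
    P.IsTriangle f f' δf → P.IsTriangle g g' δg → P.IsTriangle h h' δh → g ≫ h' = f' →
    ∃ (d : D ⟶ E) (e : E ⟶ F) (θ : EExt P.E F D),
      P.IsTriangle d e θ ∧ f ≫ g = d ≫ h ∧ h ≫ g' = e ∧
      EExt.push d δf = δh ∧ EExt.push f θ = δg ∧ EExt.pull g' θ + EExt.pull h' δf = 0

/-- (ET4-5) -/
def ET4_5 {𝒞 : Type u} [Category.{v} 𝒞] [Preadditive 𝒞] [HasZeroObject 𝒞]
    [HasBinaryBiproducts 𝒞] (P : PreExtriangulated.{w} 𝒞) : Prop :=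
  ∀ ⦃A₁ B₁ A₂ B₂ C : 𝒞⦄ (x₁ : A₁ ⟶ B₁) (y₁ : B₁ ⟶ C) (δ : EExt P.E C A₁)
    (x₂ : A₂ ⟶ B₂) (y₂ : B₂ ⟶ C) (δ' : EExt P.E C A₂) (g : B₁ ⟶ B₂),
    P.IsTriangle x₁ y₁ δ → P.IsTriangle x₂ y₂ δ' → g ≫ y₂ = y₁ →
    ∃ f : A₁ ⟶ A₂, P.IsTriangleMorphism x₁ y₁ δ x₂ y₂ δ' f g (𝟙 C) ∧
      P.HomotopyCartesian x₁ f g x₂ (EExt.pull y₂ δ)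

end PreExtriangulated

namespace PreExtriangulated

theorem exists_factor {𝒞 : Type u} [Category.{v} 𝒞] [Preadditive 𝒞] [HasZeroObject 𝒞]
    [HasBinaryBiproducts 𝒞] (P : PreExtriangulated.{w} 𝒞) {A B C D : 𝒞} {x : A ⟶ B} {y : B ⟶ C}
    {δ : EExt P.E C A} (h : P.IsTriangle x y δ) (m : B ⟶ D) (hm : x ≫ m = 0) :
    ∃ t : C ⟶ D, m = y ≫ t := by
  have h₀ : P.IsTriangle (0 : (0 : 𝒞) ⟶ D) (𝟙 D) 0 := by
    refine (P.realization_zero _ _).trans (Quotient.sound ⟨⟨biprod.snd, biprod.inr, ?_, ?_⟩, ?_, ?_⟩)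
    · apply biprod.hom_ext
      · exact (isZero_zero 𝒞).eq_of_tgt _ _
      · simp
    · simp
    · exact (isZero_zero 𝒞).eq_of_src _ _
    · simp
  obtain ⟨c, hc, -⟩ := P.et3 _ _ _ _ _ _ (0 : A ⟶ 0) m h h₀ (by simp [hm])
  exact ⟨c, by simp [hc]⟩

theorem isIso_of_comm {𝒞 : Type u} [Category.{v} 𝒞] [Preadditive 𝒞] [HasZeroObject 𝒞]
    [HasBinaryBiproducts 𝒞] (P : PreExtriangulated.{w} 𝒞) {A B C : 𝒞} {x : A ⟶ B} {y : B ⟶ C}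
    {δ : EExt P.E C A} (h : P.IsTriangle x y δ) (k : B ⟶ B) (h₁ : x ≫ k = x) (h₂ : k ≫ y = y) :
    IsIso k := by
  obtain ⟨t, ht⟩ := P.exists_factor h (k - 𝟙 B) (by simp [h₁])
  have hk : k = 𝟙 B + y ≫ t := by rw [← ht]; abel
  have hz : y ≫ t ≫ y = 0 := by
    rw [← Category.assoc, ← ht]; simp [h₂]
  have hz' : y ≫ t ≫ y ≫ t = 0 := by
    have := congrArg (fun r => r ≫ t) hz
    simpa using this
  refine ⟨𝟙 B - y ≫ t, ?_, ?_⟩ <;> rw [hk] <;> simp [hz']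

/-- Transport of an `𝔼`-triangle along isomorphisms of the end terms. -/
theorem isTriangle_transport {𝒞 : Type u} [Category.{v} 𝒞] [Preadditive 𝒞] [HasZeroObject 𝒞]
    [HasBinaryBiproducts 𝒞] (P : PreExtriangulated.{w} 𝒞) {A B C A' C' : 𝒞} {x : A ⟶ B}
    {y : B ⟶ C} {δ : EExt P.E C A} (h : P.IsTriangle x y δ) (a : A ≅ A') (c : C' ≅ C) :
    P.IsTriangle (a.inv ≫ x) (y ≫ c.inv) (EExt.push a.hom (EExt.pull c.hom δ)) := by
  obtain ⟨⟨B', x', y'⟩, h'⟩ := Quotient.exists_rep (P.s (EExt.push a.hom (EExt.pull c.hom δ)))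
  have h' := h'.symm
  obtain ⟨b, h₁, h₂⟩ := P.realization _ _ _ _ _ _ a.hom c.inv h h' (by
    simp [EExt.IsMorphism, EExt.push_pull, EExt.pull_pull, EExt.pull_id])
  obtain ⟨b', h₃, h₄⟩ := P.realization _ _ _ _ _ _ a.inv c.hom h' h (by
    simp [EExt.IsMorphism, EExt.push_push, EExt.push_id])
  have i₁ : IsIso (b ≫ b') := P.isIso_of_comm h _ (by rw [← Category.assoc, h₁]; simp [h₃])
    (by rw [Category.assoc, ← h₄, ← Category.assoc, ← h₂]; simp)
  have i₂ : IsIso (b' ≫ b) := P.isIso_of_comm h' _ (by rw [← Category.assoc, h₃]; simp [h₁])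
    (by rw [Category.assoc, ← h₂, ← Category.assoc, ← h₄]; simp)
  have : IsIso b := by
    have : Mono b := mono_of_mono b b'
    have : IsSplitEpi b := IsSplitEpi.mk' ⟨inv (b' ≫ b) ≫ b', by simp⟩
    exact isIso_of_mono_of_isSplitEpi b
  refine h'.trans (Quotient.sound ⟨(asIso b).symm, ?_, ?_⟩)
  · simp only [Iso.symm_hom, asIso_inv]
    rw [IsIso.comp_inv_eq, Category.assoc, h₁]; simp
  · simp only [Iso.symm_hom, asIso_inv]
    rw [IsIso.inv_comp_eq, h₂]

end PreExtriangulated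

section Opposite

/-- The comparison between biproducts in `𝒞ᵒᵖ` and in `𝒞`. -/
noncomputable def unopBiprodIso {𝒞 : Type u} [Category.{v} 𝒞] [Preadditive 𝒞]
    [HasBinaryBiproducts 𝒞] (X Y : 𝒞ᵒᵖ) : X.unop ⊞ Y.unop ≅ (X ⊞ Y).unop where
  hom := biprod.desc (biprod.fst : X ⊞ Y ⟶ X).unop (biprod.snd : X ⊞ Y ⟶ Y).unop
  inv := biprod.lift (biprod.inl : X ⟶ X ⊞ Y).unop (biprod.inr : Y ⟶ X ⊞ Y).unop
  hom_inv_id := by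
    apply biprod.hom_ext' <;> apply biprod.hom_ext <;> simp [← unop_comp]
  inv_hom_id := by
    rw [biprod.lift_desc, ← unop_comp, ← unop_comp, ← unop_add, biprod.total, unop_id]

/-- The bifunctor on the opposite category: `𝔼ᵒᵖ(Cᵒᵖ, Aᵒᵖ) = 𝔼(A, C)`. -/
def oppositeBifunctor {𝒞 : Type u} [Category.{v} 𝒞] (E : 𝒞ᵒᵖ ⥤ 𝒞 ⥤ AddCommGrpCat.{w}) :
    𝒞ᵒᵖᵒᵖ ⥤ 𝒞ᵒᵖ ⥤ AddCommGrpCat.{w} :=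
  unopUnop 𝒞 ⋙ E.flip

theorem eq_mk_opposite_iff {𝒞 : Type u} [Category.{v} 𝒞] {A B C : 𝒞ᵒᵖ} (x : A ⟶ B) (y : B ⟶ C)
    (q : Quotient (ESeq.setoid C.unop A.unop)) :
    (Quotient.map ESeq.opposite ESeq.opposite_equiv q : Quotient (ESeq.setoid A C)) =
      Quotient.mk _ ⟨B, x, y⟩ ↔ q = Quotient.mk _ ⟨B.unop, y.unop, x.unop⟩ := by
  induction q using Quotient.inductionOn with
  | h S =>
    rw [Quotient.map_mk, Quotient.eq, Quotient.eq]
    constructor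
    · intro h
      exact ESeq.equiv_of_opposite S ⟨B.unop, y.unop, x.unop⟩ h
    · intro h
      exact ESeq.opposite_equiv S ⟨B.unop, y.unop, x.unop⟩ h

theorem EExt.push_pull_unop_sum {𝒞 : Type u} [Category.{v} 𝒞] [Preadditive 𝒞]
    [HasBinaryBiproducts 𝒞] {E : 𝒞ᵒᵖ ⥤ 𝒞 ⥤ AddCommGrpCat.{w}} {A C A' C' : 𝒞ᵒᵖ}
    (δ : EExt E A.unop C.unop) (δ' : EExt E A'.unop C'.unop) :
    push (unopBiprodIso C C').hom (pull (unopBiprodIso A A').symm.hom (sum δ δ')) =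
      sum (E := oppositeBifunctor E) (A := A) (C := C) (A' := A') (C' := C') δ δ' := by
  have i₁ : biprod.inl ≫ (unopBiprodIso C C').hom = (biprod.fst : C ⊞ C' ⟶ C).unop := by
    simp [unopBiprodIso]
  have i₂ : biprod.inr ≫ (unopBiprodIso C C').hom = (biprod.snd : C ⊞ C' ⟶ C').unop := by
    simp [unopBiprodIso]
  have i₃ : (unopBiprodIso A A').inv ≫ biprod.fst = (biprod.inl : A ⟶ A ⊞ A').unop := by
    simp [unopBiprodIso]
  have i₄ : (unopBiprodIso A A').inv ≫ biprod.snd = (biprod.inr : A' ⟶ A ⊞ A').unop := by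
    simp [unopBiprodIso]
  have key := push_pull_sum δ δ' (unopBiprodIso C C').hom (unopBiprodIso A A').symm.hom
  rw [i₁, i₂, Iso.symm_hom, i₃, i₄] at key
  exact key

namespace PreExtriangulated

/-- The opposite pre-extriangulated structure, on `𝒞ᵒᵖ`: its extensions of `Cᵒᵖ` by `Aᵒᵖ` are those
of `A` by `C`, and its `𝔼`-triangles are those of `𝒞` with the arrows reversed. -/
def opposite {𝒞 : Type u} [Category.{v} 𝒞] [Preadditive 𝒞] [HasZeroObject 𝒞]
    [HasBinaryBiproducts 𝒞] (P : PreExtriangulated.{w} 𝒞) : PreExtriangulated.{w} 𝒞ᵒᵖ where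
  E := oppositeBifunctor P.E
  additive_fst := ⟨fun {X Y f g} => by
    ext Z z
    have := P.additive_snd Z
    exact congrArg (fun k => k z)
      (Functor.map_add (P.E.obj Z) (f := f.unop.unop) (g := g.unop.unop))⟩
  additive_snd X := ⟨fun {Y Z f g} => by
    have := P.additive_fst
    exact congrArg (fun k => k.app X.unop.unop) (Functor.map_add P.E (f := f) (g := g))⟩
  s {A C} δ := Quotient.map ESeq.opposite ESeq.opposite_equiv
    (P.s (A := C.unop) (C := A.unop) δ)
  realization x y δ x' y' δ' a c h h' hac := by
    rw [eq_mk_opposite_iff] at h h'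
    obtain ⟨b, h₁, h₂⟩ := P.realization _ _ _ _ _ _ c.unop a.unop h' h hac.symm
    exact ⟨b.op, Quiver.Hom.unop_inj h₂.symm, Quiver.Hom.unop_inj h₁.symm⟩
  realization_zero A C := by
    rw [eq_mk_opposite_iff]
    refine (P.realization_zero C.unop A.unop).trans (Quotient.sound
      ⟨biprod.braiding _ _ ≪≫ unopBiprodIso A C, ?_, ?_⟩)
    · simp [unopBiprodIso]
    · apply biprod.hom_ext' <;> simp [unopBiprodIso, ← unop_comp]
  realization_sum {A B C A' B' C'} x y δ x' y' δ' h h' := by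
    rw [eq_mk_opposite_iff] at h h' ⊢
    have key := P.isTriangle_transport (P.realization_sum _ _ _ _ _ _ h h')
      (unopBiprodIso C C') (unopBiprodIso A A').symm
    have hsum := EExt.push_pull_unop_sum (E := P.E) (A := A) (C := C) (A' := A') (C' := C') δ δ'
    refine ((congrArg P.s hsum).symm.trans key).trans (Quotient.sound ⟨unopBiprodIso B B', ?_, ?_⟩)
    · change ((unopBiprodIso C C').inv ≫ biprod.map y.unop y'.unop) ≫ (unopBiprodIso B B').hom =
        (biprod.map y y').unop
      rw [Category.assoc, Iso.inv_comp_eq]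
      apply biprod.hom_ext' <;> simp [unopBiprodIso, ← unop_comp]
    · change (unopBiprodIso B B').hom ≫ (biprod.map x x').unop =
        biprod.map x.unop x'.unop ≫ (unopBiprodIso A A').hom
      apply biprod.hom_ext' <;> simp [unopBiprodIso, ← unop_comp]
  et3 x y δ x' y' δ' a b h h' hab := by
    rw [eq_mk_opposite_iff] at h h'
    obtain ⟨c, h₁, h₂⟩ := P.et3op _ _ _ _ _ _ b.unop a.unop h' h
      (congrArg Quiver.Hom.unop hab).symm
    exact ⟨c.op, Quiver.Hom.unop_inj h₁.symm, h₂.symm⟩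
  et3op x y δ x' y' δ' b c h h' hbc := by
    rw [eq_mk_opposite_iff] at h h'
    obtain ⟨a, h₁, h₂⟩ := P.et3 _ _ _ _ _ _ c.unop b.unop h' h
      (congrArg Quiver.Hom.unop hbc).symm
    exact ⟨a.op, Quiver.Hom.unop_inj h₁.symm, h₂.symm⟩

theorem opposite_isTriangle_iff {𝒞 : Type u} [Category.{v} 𝒞] [Preadditive 𝒞] [HasZeroObject 𝒞]
    [HasBinaryBiproducts 𝒞] (P : PreExtriangulated.{w} 𝒞) {A B C : 𝒞ᵒᵖ} (x : A ⟶ B) (y : B ⟶ C)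
    (δ : EExt P.opposite.E C A) :
    P.opposite.IsTriangle x y δ ↔
      P.IsTriangle (A := C.unop) (C := A.unop) y.unop x.unop δ :=
  eq_mk_opposite_iff x y _

/-- (ET4) for the opposite structure is (ET4)ᵒᵖ. -/
theorem opposite_ET4_iff {𝒞 : Type u} [Category.{v} 𝒞] [Preadditive 𝒞] [HasZeroObject 𝒞]
    [HasBinaryBiproducts 𝒞] (P : PreExtriangulated.{w} 𝒞) : P.opposite.ET4 ↔ P.ET4op := by
  constructor
  · intro H A B C D F f' f δ g' g δ' h h'
    obtain ⟨E, k, k', δ'', d, e, h₁, h₂, h₃, h₄, h₅, h₆, h₇⟩ := H (A := op C) (B := op B)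
      (C := op A) (D := op F) (F := op D) g.op g'.op δ' f.op f'.op δ
      ((P.opposite_isTriangle_iff _ _ _).2 h') ((P.opposite_isTriangle_iff _ _ _).2 h)
    exact ⟨E.unop, k'.unop, k.unop, δ'', e.unop, d.unop, congrArg Quiver.Hom.unop h₃,
      (congrArg Quiver.Hom.unop h₂).symm, congrArg Quiver.Hom.unop h₁,
      (P.opposite_isTriangle_iff _ _ _).1 h₅, (P.opposite_isTriangle_iff _ _ _).1 h₄,
      h₆.symm, h₇.symm⟩
  · intro H A B C D F f f' δ g g' δ' h h'
    obtain ⟨E, k', k, δ'', d, e, h₁, h₂, h₃, h₄, h₅, h₆, h₇⟩ := H (A := C.unop) (B := B.unop)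
      (C := A.unop) (D := F.unop) (F := D.unop) g'.unop g.unop δ' f'.unop f.unop δ
      ((P.opposite_isTriangle_iff _ _ _).1 h') ((P.opposite_isTriangle_iff _ _ _).1 h)
    exact ⟨op E, k.op, k'.op, δ'', e.op, d.op, Quiver.Hom.unop_inj h₃,
      Quiver.Hom.unop_inj h₂.symm, Quiver.Hom.unop_inj h₁,
      (P.opposite_isTriangle_iff _ _ _).2 h₅, (P.opposite_isTriangle_iff _ _ _).2 h₄,
      h₆.symm, h₇.symm⟩

end PreExtriangulated

end Opposite

/-! All conditions are compared with (ET4-2), which says that the cone of `(-f, x) : A ⟶ D ⊞ B` is a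
realization of the pushout `f_* δ`. Three tools do the work. Comparison with the trivial triangles
`A ⟶ A ⟶ 0` and `0 ⟶ C ⟶ C` gives exactness at the end and middle terms. Hence cones and cocones are
unique up to isomorphism, extensions included. Finally, shears of a direct sum correct a map whose
choice is wrong only by a factorization through the triangle.

Given (ET4-3), factor `(-f, x)` through the split graph `A ⟶ D ⊞ A`; the octahedron of this
factorization is (ET4-2). Conversely, two uses of (ET4-2) produce two cones of `(-f', g) : B ⟶ D ⊞
C`, and identifying them gives (ET4-3). (ET4) and (ET4-3) differ only by uniqueness of cones, and
(ET4-5) and (ET4-2) only by a shear. (ET4-1) gives (ET4-2) because `y^* f_* δ = 0` splits the middle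
object.

Duality enters through the dual of (ET4-2), which implies (ET4-1): two cocones of `B₂ ⊞ B₁ ⟶ C`
coincide. Since (ET4-1) implies (ET4-2), the dual of (ET4-2) implies (ET4-2). The same argument in
the opposite category gives the converse, so (ET4-2) is self-dual without any use of (ET0). Thus
(ET4)ᵒᵖ is available as well; with (ET4) it yields (ET4-4), and (ET4-4) applied to a graph returns
(ET4-5). -/

namespace EExt

variable {𝒞 : Type u} [Category.{v} 𝒞] {E : 𝒞ᵒᵖ ⥤ 𝒞 ⥤ AddCommGrpCat.{w}}

theorem push_zero {C A A' : 𝒞} (a : A ⟶ A') : push a (0 : EExt E C A) = 0 := by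
  simp [push]

theorem pull_zero {C C' A : 𝒞} (c : C' ⟶ C) : pull c (0 : EExt E C A) = 0 := by
  simp [pull]

theorem push_neg {C A A' : 𝒞} (a : A ⟶ A') (δ : EExt E C A) : push a (-δ) = -push a δ := by
  simp [push]

end EExt

/-! ### Additivity, exactness, uniqueness of cones, and shears. -/

namespace PreExtriangulated

open EExt

variable {𝒞 : Type u} [Category.{v} 𝒞] [Preadditive 𝒞] [HasZeroObject 𝒞] [HasBinaryBiproducts 𝒞]
  (P : PreExtriangulated.{w} 𝒞)

theorem add_push {C A A' : 𝒞} (a b : A ⟶ A') (δ : EExt P.E C A) :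
    push (a + b) δ = push a δ + push b δ := by
  have := P.additive_snd (op C)
  simp [push, Functor.map_add]

theorem add_pull {C C' A : 𝒞} (c d : C' ⟶ C) (δ : EExt P.E C A) :
    pull (c + d) δ = pull c δ + pull d δ := by
  have := P.additive_fst
  simp [pull, Functor.map_add]

theorem zero_push {C A A' : 𝒞} (δ : EExt P.E C A) : push (0 : A ⟶ A') δ = 0 := by
  have := P.add_push (0 : A ⟶ A') 0 δ
  simpa using this

theorem zero_pull {C C' A : 𝒞} (δ : EExt P.E C A) : pull (0 : C' ⟶ C) δ = 0 := by
  have := P.add_pull (0 : C' ⟶ C) 0 δ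
  simpa using this

theorem neg_push {C A A' : 𝒞} (a : A ⟶ A') (δ : EExt P.E C A) : push (-a) δ = -push a δ := by
  rw [eq_neg_iff_add_eq_zero, ← add_push, neg_add_cancel, zero_push]

theorem neg_pull {C C' A : 𝒞} (c : C' ⟶ C) (δ : EExt P.E C A) : pull (-c) δ = -pull c δ := by
  rw [eq_neg_iff_add_eq_zero, ← add_pull, neg_add_cancel, zero_pull]

theorem sub_push {C A A' : 𝒞} (a b : A ⟶ A') (δ : EExt P.E C A) :
    push (a - b) δ = push a δ - push b δ := by
  rw [sub_eq_add_neg, add_push, neg_push, sub_eq_add_neg]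

theorem sub_pull {C C' A : 𝒞} (c d : C' ⟶ C) (δ : EExt P.E C A) :
    pull (c - d) δ = pull c δ - pull d δ := by
  rw [sub_eq_add_neg, add_pull, neg_pull, sub_eq_add_neg]

theorem exists_isTriangle {A C : 𝒞} (δ : EExt P.E C A) :
    ∃ (B : 𝒞) (x : A ⟶ B) (y : B ⟶ C), P.IsTriangle x y δ := by
  obtain ⟨⟨B, x, y⟩, h⟩ := Quotient.exists_rep (P.s δ)
  exact ⟨B, x, y, h.symm⟩

variable {P}

/-- Two realizations of the same extension are isomorphic. -/
theorem IsTriangle.exists_iso {A B B' C : 𝒞} {x : A ⟶ B} {y : B ⟶ C} {x' : A ⟶ B'} {y' : B' ⟶ C}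
    {δ : EExt P.E C A} (h : P.IsTriangle x y δ) (h' : P.IsTriangle x' y' δ) :
    ∃ b : B ≅ B', x ≫ b.hom = x' ∧ b.hom ≫ y' = y :=
  Quotient.exact (h.symm.trans h')

/-- Transport of an `𝔼`-triangle along an isomorphism of the middle term. -/
theorem IsTriangle.mid_iso {A B B' C : 𝒞} {x : A ⟶ B} {y : B ⟶ C} {δ : EExt P.E C A}
    (h : P.IsTriangle x y δ) (b : B ≅ B') {x' : A ⟶ B'} {y' : B' ⟶ C} (hx : x ≫ b.hom = x')
    (hy : b.hom ≫ y' = y) : P.IsTriangle x' y' δ :=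
  h.trans (Quotient.sound ⟨b, hx, hy⟩)

theorem IsTriangle.right_iso {A B C C' : 𝒞} {x : A ⟶ B} {y : B ⟶ C} {δ : EExt P.E C A}
    (h : P.IsTriangle x y δ) (c : C' ≅ C) {y' : B ⟶ C'} {δ' : EExt P.E C' A}
    (hy : y' ≫ c.hom = y) (hδ : pull c.hom δ = δ') : P.IsTriangle x y' δ' := by
  have := P.isTriangle_transport h (Iso.refl A) c
  rw [Iso.refl_hom, push_id, hδ] at this
  simpa [← hy] using this

theorem IsTriangle.left_iso {A A' B C : 𝒞} {x : A ⟶ B} {y : B ⟶ C} {δ : EExt P.E C A}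
    (h : P.IsTriangle x y δ) (a : A ≅ A') {x' : A' ⟶ B} {δ' : EExt P.E C A'}
    (hx : a.hom ≫ x' = x) (hδ : push a.hom δ = δ') : P.IsTriangle x' y δ' := by
  have := P.isTriangle_transport h a (Iso.refl C)
  rw [Iso.refl_hom, pull_id, hδ] at this
  simpa [← hx] using this

variable (P)

theorem isTriangle_inl_snd (A C : 𝒞) :
    P.IsTriangle (biprod.inl : A ⟶ A ⊞ C) (biprod.snd : A ⊞ C ⟶ C) 0 :=
  P.realization_zero A C

/-- A direct sum decomposition of the middle term is an `𝔼`-triangle with extension `0`. -/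
theorem isTriangle_of_splitting {A B C : 𝒞} {i : A ⟶ B} {q : B ⟶ C} {r : B ⟶ A} {j : C ⟶ B}
    (hir : i ≫ r = 𝟙 A) (hjq : j ≫ q = 𝟙 C) (hiq : i ≫ q = 0) (hjr : j ≫ r = 0)
    (h : r ≫ i + q ≫ j = 𝟙 B) : P.IsTriangle i q 0 := by
  refine (P.isTriangle_inl_snd A C).mid_iso ⟨biprod.desc i j, biprod.lift r q, ?_, ?_⟩ ?_ ?_
  · apply biprod.hom_ext' <;> apply biprod.hom_ext <;> simp [*]
  · simp [h]
  · simp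
  · apply biprod.hom_ext' <;> simp [*]

theorem isTriangle_id_zero (A : 𝒞) : P.IsTriangle (𝟙 A) (0 : A ⟶ (0 : 𝒞)) 0 :=
  P.isTriangle_of_splitting (r := 𝟙 A) (j := 0) (by simp)
    ((isZero_zero 𝒞).eq_of_src _ _) (by simp) (by simp) (by simp)

theorem isTriangle_zero_id (C : 𝒞) : P.IsTriangle (0 : (0 : 𝒞) ⟶ C) (𝟙 C) 0 :=
  P.isTriangle_of_splitting (r := 0) (j := 𝟙 C) ((isZero_zero 𝒞).eq_of_src _ _)
    (by simp) (by simp) (by simp) (by simp)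

variable {P} {A B C : 𝒞} {x : A ⟶ B} {y : B ⟶ C} {δ : EExt P.E C A}

/-- This and the exactness statements that follow come from mapping to or from a trivial triangle `X
⟶ X ⟶ 0` or `0 ⟶ X ⟶ X`, using (ET3), its dual, or the realization axiom. -/
theorem IsTriangle.comp_eq_zero (h : P.IsTriangle x y δ) : x ≫ y = 0 := by
  obtain ⟨c, hc, -⟩ := P.et3 _ _ _ _ _ _ (𝟙 A) x (P.isTriangle_id_zero A) h (by simp)
  simpa using hc.symm

theorem IsTriangle.push_eq_zero (h : P.IsTriangle x y δ) : push x δ = 0 := by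
  obtain ⟨c, -, hc⟩ := P.et3 _ _ _ _ _ _ x (𝟙 B) h (P.isTriangle_id_zero B) (by simp)
  exact hc.trans (pull_zero _)

theorem IsTriangle.pull_eq_zero (h : P.IsTriangle x y δ) : pull y δ = 0 := by
  obtain ⟨a, -, ha⟩ := P.et3op _ _ _ _ _ _ (𝟙 B) y (P.isTriangle_zero_id B) h (by simp)
  exact ha.symm.trans (push_zero _)

theorem IsTriangle.exists_eq_snd_comp (h : P.IsTriangle x y δ) {D : 𝒞} {m : B ⟶ D}
    (hm : x ≫ m = 0) : ∃ t : C ⟶ D, m = y ≫ t :=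
  P.exists_factor h m hm

theorem IsTriangle.exists_eq_comp_fst (h : P.IsTriangle x y δ) {D : 𝒞} {m : D ⟶ B}
    (hm : m ≫ y = 0) : ∃ t : D ⟶ A, m = t ≫ x := by
  obtain ⟨a, ha, -⟩ := P.et3op _ _ _ _ _ _ m (0 : (0 : 𝒞) ⟶ C) (P.isTriangle_id_zero D) h
    (by simp [hm])
  exact ⟨a, by simpa using ha⟩

theorem IsTriangle.exists_eq_comp_snd (h : P.IsTriangle x y δ) {D : 𝒞} {c : D ⟶ C}
    (hc : pull c δ = 0) : ∃ t : D ⟶ B, c = t ≫ y := by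
  obtain ⟨b, -, hb⟩ := P.realization _ _ _ _ _ _ (0 : (0 : 𝒞) ⟶ A) c (P.isTriangle_zero_id D) h
    ((push_zero _).trans hc.symm)
  exact ⟨b, by simpa using hb⟩

theorem IsTriangle.exists_eq_fst_comp (h : P.IsTriangle x y δ) {D : 𝒞} {a : A ⟶ D}
    (ha : push a δ = 0) : ∃ t : B ⟶ D, a = x ≫ t := by
  obtain ⟨b, hb, -⟩ := P.realization _ _ _ _ _ _ a (0 : C ⟶ (0 : 𝒞)) h (P.isTriangle_id_zero D)
    (ha.trans (pull_zero _).symm)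
  exact ⟨b, by simpa using hb.symm⟩

/-- An endomorphism which differs from the identity by a square zero endomorphism is invertible. -/
theorem isIso_of_sub_comp_sub {𝒟 : Type u} [Category.{v} 𝒟] [Preadditive 𝒟] {X : 𝒟} (c : X ⟶ X)
    (hc : (c - 𝟙 X) ≫ (c - 𝟙 X) = 0) : IsIso c := by
  have hc' : c ≫ c - c - (c - 𝟙 X) = 0 := by simpa using hc
  have hcc : c ≫ c = c + (c - 𝟙 X) := by
    rw [sub_sub, sub_eq_zero] at hc'
    exact hc'
  exact ⟨𝟙 X + 𝟙 X - c, by simp [hcc], by simp [hcc]⟩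

theorem isIso_of_isIso_comp {𝒟 : Type u} [Category.{v} 𝒟] {X Y : 𝒟} (b : X ⟶ Y) (b' : Y ⟶ X)
    [IsIso (b ≫ b')] [IsIso (b' ≫ b)] : IsIso b := by
  have : Mono b := mono_of_mono b b'
  have : IsSplitEpi b := IsSplitEpi.mk' ⟨inv (b' ≫ b) ≫ b', by simp⟩
  exact isIso_of_mono_of_isSplitEpi b

/-- The difference `c - 𝟙 C` annihilates `δ`, so it factors through `y`; it is also annihilated by
`y` on the left. Hence its square is zero. -/
theorem IsTriangle.isIso_right (h : P.IsTriangle x y δ) {c : C ⟶ C} (hy : y ≫ c = y)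
    (hδ : pull c δ = δ) : IsIso c := by
  obtain ⟨t, ht⟩ := h.exists_eq_comp_snd (c := c - 𝟙 C) (by rw [P.sub_pull, hδ, pull_id, sub_self])
  refine isIso_of_sub_comp_sub c ?_
  nth_rewrite 1 [ht]
  simp [hy]

theorem IsTriangle.isIso_left (h : P.IsTriangle x y δ) {a : A ⟶ A} (hx : a ≫ x = x)
    (hδ : push a δ = δ) : IsIso a := by
  obtain ⟨t, ht⟩ := h.exists_eq_fst_comp (a := a - 𝟙 A) (by rw [P.sub_push, hδ, push_id, sub_self])
  refine isIso_of_sub_comp_sub a ?_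
  nth_rewrite 2 [ht]
  rw [← Category.assoc, Preadditive.sub_comp, hx]
  simp

/-- The cone of an inflation is unique up to isomorphism. -/
theorem IsTriangle.exists_iso_right (h : P.IsTriangle x y δ) {C' : 𝒞} {y' : B ⟶ C'}
    {δ' : EExt P.E C' A} (h' : P.IsTriangle x y' δ') :
    ∃ c : C ≅ C', y ≫ c.hom = y' ∧ pull c.hom δ' = δ := by
  obtain ⟨c, hc, hc'⟩ := P.et3 _ _ _ _ _ _ (𝟙 A) (𝟙 B) h h' (by simp)
  obtain ⟨d, hd, hd'⟩ := P.et3 _ _ _ _ _ _ (𝟙 A) (𝟙 B) h' h (by simp)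
  simp only [IsMorphism, push_id, Category.id_comp] at hc hc' hd hd'
  have := h.isIso_right (c := c ≫ d) (by rw [← Category.assoc, hc, hd])
    (by rw [← pull_pull, ← hd', ← hc'])
  have := h'.isIso_right (c := d ≫ c) (by rw [← Category.assoc, hd, hc])
    (by rw [← pull_pull, ← hc', ← hd'])
  have := isIso_of_isIso_comp c d
  exact ⟨asIso c, hc, hc'.symm⟩

/-- The cocone of a deflation is unique up to isomorphism. -/
theorem IsTriangle.exists_iso_left (h : P.IsTriangle x y δ) {A' : 𝒞} {x' : A' ⟶ B}
    {δ' : EExt P.E C A'} (h' : P.IsTriangle x' y δ') :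
    ∃ a : A ≅ A', a.hom ≫ x' = x ∧ push a.hom δ = δ' := by
  obtain ⟨c, hc, hc'⟩ := P.et3op _ _ _ _ _ _ (𝟙 B) (𝟙 C) h h' (by simp)
  obtain ⟨d, hd, hd'⟩ := P.et3op _ _ _ _ _ _ (𝟙 B) (𝟙 C) h' h (by simp)
  simp only [IsMorphism, pull_id, Category.comp_id] at hc hc' hd hd'
  have := h.isIso_left (a := c ≫ d) (by rw [Category.assoc, ← hd, ← hc])
    (by rw [← push_push, hc', hd'])
  have := h'.isIso_left (a := d ≫ c) (by rw [Category.assoc, ← hc, ← hd])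
    (by rw [← push_push, hd', hc'])
  have := isIso_of_isIso_comp c d
  exact ⟨asIso c, hc.symm, hc'⟩

/-- Negating the deflation negates the extension. -/
theorem IsTriangle.neg_right (h : P.IsTriangle x y δ) : P.IsTriangle x (-y) (-δ) :=
  h.right_iso ⟨-𝟙 C, -𝟙 C, by simp, by simp⟩ (by simp) (by rw [P.neg_pull, pull_id])

/-- A retraction of the inflation of an `𝔼`-triangle with extension `0` gives a direct sum
decomposition of the middle term. -/
theorem IsTriangle.exists_section {r : B ⟶ A} (h : P.IsTriangle x y (0 : EExt P.E C A))
    (hr : x ≫ r = 𝟙 A) : ∃ j : C ⟶ B, j ≫ y = 𝟙 C ∧ j ≫ r = 0 ∧ r ≫ x + y ≫ j = 𝟙 B := by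
  -- `j` is an arbitrary section of `y`; `t = j ≫ (𝟙 B - r ≫ x)` is its correction by the projector
  -- complementary to `r ≫ x`, so that `t ≫ r = 0`.
  obtain ⟨j, hj⟩ := h.exists_eq_comp_snd (c := 𝟙 C) (pull_zero _)
  obtain ⟨t, ht⟩ := h.exists_eq_snd_comp (m := 𝟙 B - r ≫ x) (by simp [reassoc_of% hr])
  have hy : (𝟙 B - r ≫ x) ≫ y = y := by simp [h.comp_eq_zero]
  have hr' : (𝟙 B - r ≫ x) ≫ r = 0 := by simp [hr]
  have htj : j ≫ (𝟙 B - r ≫ x) = t := by rw [ht, ← Category.assoc, ← hj, Category.id_comp]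
  refine ⟨t, ?_, ?_, ?_⟩
  · rw [← htj, Category.assoc, hy, hj]
  · rw [← htj, Category.assoc, hr', comp_zero]
  · rw [← ht]; abel

/-- The direct sum with `0 ⟶ X ⟶ X`. -/
theorem IsTriangle.sum_zero_id (h : P.IsTriangle x y δ) (X : 𝒞) :
    P.IsTriangle (x ≫ biprod.inl : A ⟶ B ⊞ X) (biprod.map y (𝟙 X)) (pull biprod.fst δ) := by
  refine IsTriangle.left_iso (P.realization_sum _ _ _ _ _ _ h (P.isTriangle_zero_id X))
    ⟨biprod.fst, biprod.inl, ?_, ?_⟩ ?_ ?_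
  · apply biprod.hom_ext'
    · simp
    · exact (isZero_zero 𝒞).eq_of_src _ _
  · simp
  · apply biprod.hom_ext'
    · simp
    · exact (isZero_zero 𝒞).eq_of_src _ _
  · simp [EExt.sum, push_push, pull_zero, push_zero, push_id]

/-- The direct sum with `X ⟶ X ⟶ 0`. -/
theorem IsTriangle.sum_id_zero (h : P.IsTriangle x y δ) (X : 𝒞) :
    P.IsTriangle (biprod.map (𝟙 X) x) (biprod.snd ≫ y) (push biprod.inr δ) := by
  refine IsTriangle.right_iso (P.realization_sum _ _ _ _ _ _ (P.isTriangle_id_zero X) h)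
    ⟨biprod.inr, biprod.snd, ?_, ?_⟩ ?_ ?_
  · simp
  · apply biprod.hom_ext
    · exact (isZero_zero 𝒞).eq_of_tgt _ _
    · simp
  · apply biprod.hom_ext
    · exact (isZero_zero 𝒞).eq_of_tgt _ _
    · simp
  · simp [EExt.sum, ← push_pull, pull_pull, pull_zero, push_zero, pull_id]

/-- An automorphism of the middle term of a homotopy cartesian square given by a shear. -/
theorem IsTriangle.shear {X Y : 𝒞} {p : A ⟶ X} {z : A ⟶ Y} {d : X ⟶ C} {g : Y ⟶ C}
    (h : P.IsTriangle (biprod.lift p z) (biprod.desc d g) δ) (w : Y ⟶ X) :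
    P.IsTriangle (biprod.lift (p + z ≫ w) z) (biprod.desc d (g - w ≫ d)) δ := by
  refine h.mid_iso ⟨biprod.desc biprod.inl (biprod.inr + w ≫ biprod.inl),
    biprod.desc biprod.inl (biprod.inr - w ≫ biprod.inl), ?_, ?_⟩ ?_ ?_
  · apply biprod.hom_ext' <;> simp
  · apply biprod.hom_ext' <;> simp
  · apply biprod.hom_ext <;> simp
  · apply biprod.hom_ext' <;> simp

end PreExtriangulated

/-! ### Implications between the conditions. -/

namespace PreExtriangulated

open EExt

variable {𝒞 : Type u} [Category.{v} 𝒞] [Preadditive 𝒞] [HasZeroObject 𝒞] [HasBinaryBiproducts 𝒞]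
  {P : PreExtriangulated.{w} 𝒞}

/-- (ET4) chooses a cone of `f ≫ g`; uniqueness of cones moves its conclusion to the prescribed one.
-/
theorem ET4.et4_3 (H : P.ET4) : P.ET4_3 := by
  intro A B C D E F f f' δf g g' δg h h₀ δh hf hg hh e
  subst e
  obtain ⟨E', _, h', δ'', d, e, rfl, h₁, h₂, h₃, h₄, h₅, h₆⟩ := H f f' δf g g' δg hf hg
  obtain ⟨c, hc, hc'⟩ := h₃.exists_iso_right hh
  refine ⟨d ≫ c.hom, c.inv ≫ e, ?_, ?_, ?_, ?_, ?_⟩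
  · rw [← Category.assoc, h₁, Category.assoc, hc]
  · rw [← h₂, ← hc]; simp
  · exact h₄.mid_iso c rfl (by simp)
  · rw [← pull_pull, hc', h₅]
  · rw [← pull_pull, ← h₆, ← hc', push_pull, pull_pull, Iso.inv_hom_id, pull_id]

theorem ET4_3.et4 (h : P.ET0) (H : P.ET4_3) : P.ET4 := by
  intro A B C D F f f' δ g g' δ' hf hg
  obtain ⟨E, h', δ'', hh⟩ := h f g ⟨_, _, _, hf⟩ ⟨_, _, _, hg⟩
  obtain ⟨d, e, h₁, h₂, h₃, h₄, h₅⟩ := H f f' δ g g' δ' _ h' δ'' hf hg hh rfl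
  exact ⟨E, _, h', δ'', d, e, rfl, h₁, h₂, hh, h₃, h₄, h₅⟩

/-- The split `𝔼`-triangle given by the graph of `f`. -/
theorem isTriangle_lift_desc (P : PreExtriangulated.{w} 𝒞) {A D : 𝒞} (f : A ⟶ D) :
    P.IsTriangle (biprod.lift (-f) (𝟙 A)) (biprod.desc (𝟙 D) f) 0 :=
  P.isTriangle_of_splitting (r := biprod.snd) (j := biprod.inl) (by simp) (by simp) (by simp)
    (by simp) (by apply biprod.hom_ext' <;> apply biprod.hom_ext <;> simp)

/-- The map `(-f, x)` is the graph `(-f, 𝟙) : A ⟶ D ⊞ A` followed by `𝟙 ⊞ x`. Both are inflations,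
so (ET0) gives the composite a cone `E₀`, and (ET4-3) exhibits `E₀` as a realization of `(𝟙, f)_*
inr_* δ = f_* δ`. -/
theorem ET4_3.et4_2 (h : P.ET0) (H : P.ET4_3) : P.ET4_2 := by
  intro A B C D E x y δ f d e hx hd
  have hs := P.isTriangle_lift_desc f
  have hm := hx.sum_id_zero D
  obtain ⟨E₀, p, ε, hε⟩ := h _ _ ⟨_, _, _, hs⟩ ⟨_, _, _, hm⟩
  obtain ⟨d₀, e₀, h₁, h₂, h₃, h₄, h₅⟩ := H _ _ _ _ _ _ _ _ _ hs hm hε rfl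
  have hl : biprod.lift (-f) (𝟙 A) ≫ biprod.map (𝟙 D) x = biprod.lift (-f) x := by
    apply biprod.hom_ext <;> simp
  rw [hl] at hε
  have h₁l : d₀ = biprod.inl ≫ p := by simpa using congrArg (biprod.inl ≫ ·) h₁
  have h₁r : f ≫ d₀ = x ≫ biprod.inr ≫ p := by simpa using congrArg (biprod.inr ≫ ·) h₁
  have h₂r : (biprod.inr ≫ p) ≫ e₀ = y := by simpa using congrArg (biprod.inr ≫ ·) h₂
  -- `biprod.snd` retracts both the graph and `biprod.inr`, so pushing out along it turns `(-f, 𝟙)_*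
  -- ε = e₀^* inr_* δ` into the claim.
  have h₅' : ε = pull e₀ δ := by
    have := congrArg (push biprod.snd) h₅
    simpa [push_push, push_pull, push_id] using this
  rw [push_push, biprod.inr_desc] at h₃
  obtain ⟨b, hb, hb'⟩ := h₃.exists_iso hd
  refine ⟨biprod.inr ≫ p ≫ b.hom, ⟨hx, hd, ?_, ?_, by simp [IsMorphism, pull_id]⟩, ?_⟩
  · rw [← hb, reassoc_of% h₁r]
  · rw [Category.comp_id, Category.assoc, Category.assoc, hb', ← h₂r, Category.assoc]
  · refine hε.right_iso b.symm ?_ ?_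
    · apply biprod.hom_ext'
      · simp [← hb, h₁l]
      · simp
    · rw [h₅', pull_pull, ← hb']; simp

/-- Pushing `δh` along `f` gives a cone `M` of `(-f, f ≫ g)`, and this cone is also `D ⊞ C`. Hence
`B ⟶ M ⟶ E` becomes a triangle starting with `(-f', g)`. Pushing `δg` along `f'` gives a second such
triangle, with a realization of `f'_* δg` as its cone, which must therefore be `E`. -/
theorem ET4_2.et4_3 (H : P.ET4_2) : P.ET4_3 := by
  intro A B C D E F f f' δf g g' δg h h₀ δh hf hg hh e
  subst e
  obtain ⟨M, d, m, hM⟩ := P.exists_isTriangle (push f δh)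
  obtain ⟨k, hk, hk'⟩ := H _ _ _ f d m hh hM
  -- The involution `(b, c) ↦ (-b, g b + c)` of `B ⊞ C` carries `(f, 0)` to `(-f, f ≫ g)`.
  have hψ : P.IsTriangle (biprod.lift (-f) (f ≫ g))
      (biprod.desc (biprod.lift (-f') g) biprod.inr : B ⊞ C ⟶ D ⊞ C) (pull biprod.fst δf) := by
    refine (hf.sum_zero_id C).mid_iso ⟨biprod.desc (biprod.lift (-𝟙 B) g) biprod.inr,
      biprod.desc (biprod.lift (-𝟙 B) g) biprod.inr, ?_, ?_⟩ ?_ ?_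
    · apply biprod.hom_ext' <;> apply biprod.hom_ext <;> simp
    · apply biprod.hom_ext' <;> apply biprod.hom_ext <;> simp
    · apply biprod.hom_ext <;> simp
    · apply biprod.hom_ext' <;> apply biprod.hom_ext <;> simp
  obtain ⟨θ, hθ, hθ'⟩ := hψ.exists_iso_right hk'
  have hθl : biprod.lift (-f') g ≫ θ.hom = d := by simpa using congrArg (biprod.inl ≫ ·) hθ
  have hθr : biprod.inr ≫ θ.hom = k := by simpa using congrArg (biprod.inr ≫ ·) hθ
  have hkm : k ≫ m = h₀ := by simpa using hk.comm_right.symm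
  have hB : P.IsTriangle (biprod.lift (-f') g) (biprod.desc (biprod.inl ≫ θ.hom ≫ m) h₀)
      (push f δh) :=
    hM.mid_iso θ.symm (by simp [← hθl])
      (by
        rw [Iso.symm_hom, Iso.inv_comp_eq]
        apply biprod.hom_ext'
        · simp
        · simp [← hkm, ← hθr])
  obtain ⟨E₁, d₁, e₁, hE⟩ := P.exists_isTriangle (push f' δg)
  obtain ⟨l, hl, hl'⟩ := H _ _ _ f' d₁ e₁ hg hE
  obtain ⟨c, hc, hc'⟩ := hl'.exists_iso_right hB
  have hcl : d₁ ≫ c.hom = biprod.inl ≫ θ.hom ≫ m := by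
    simpa using congrArg (biprod.inl ≫ ·) hc
  have hcr : l ≫ c.hom = h₀ := by simpa using congrArg (biprod.inr ≫ ·) hc
  refine ⟨biprod.inl ≫ θ.hom ≫ m, c.inv ≫ e₁, ?_, ?_, hE.mid_iso c hcl (by simp), ?_, ?_⟩
  · rw [← hcl, ← hcr, reassoc_of% hl.comm_left]
  · rw [← hcr]
    simpa using hl.comm_right.symm
  · rw [← Category.assoc, ← pull_pull, ← pull_pull]
    have := congrArg (pull biprod.inl) hθ'
    simpa [pull_pull, pull_id] using this
  · have := congrArg (pull c.inv) hc'
    rw [pull_pull, pull_pull, Iso.inv_hom_id, pull_id] at this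
    exact this

/-- (ET4-2) yields some `g'` in place of `g`. The difference is annihilated by `y₂`, so it is `w ≫
x₂`, and a shear restores `g` at the price of replacing `f` by `f + x₁ ≫ w`. This does not change
`f_* δ`, since `x₁_* δ = 0`. -/
theorem ET4_2.et4_5 (H : P.ET4_2) : P.ET4_5 := by
  intro A₁ B₁ A₂ B₂ C x₁ y₁ δ x₂ y₂ δ' g h₁ h₂ hg
  obtain ⟨f, hf, hf'⟩ := P.et3op _ _ _ _ _ _ g (𝟙 C) h₁ h₂ (by simp [hg])
  have hf'' : push f δ = δ' := hf'.trans (pull_id _)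
  obtain ⟨g', hg', hg''⟩ := H _ _ _ f x₂ y₂ h₁ (hf''.symm ▸ h₂)
  obtain ⟨w, hw⟩ := h₂.exists_eq_comp_fst (m := g - g') (by
    rw [Preadditive.sub_comp, hg, ← hg'.comm_right, Category.comp_id, sub_self])
  have hg₁ : g' - (-w) ≫ x₂ = g := by rw [Preadditive.neg_comp, ← hw]; abel
  have hc : x₁ ≫ g = (f + x₁ ≫ w) ≫ x₂ := by
    rw [Preadditive.add_comp, Category.assoc, ← hw, Preadditive.comp_sub, hg'.comm_left]; abel
  have hs := hg''.shear (-w)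
  rw [hg₁] at hs
  refine ⟨f + x₁ ≫ w, ⟨h₁, h₂, hc, by simp [hg], ?_⟩, hc, ?_⟩
  · rw [IsMorphism, P.add_push, ← push_push, h₁.push_eq_zero, push_zero, add_zero, hf'', pull_id]
  · convert hs using 2
    rw [Preadditive.comp_neg, neg_add]

/-- Here `f` is prescribed and `g` is free. The map `f₁` from (ET4-5) has the same pushout of `δ` as
`f`, so `f₁ - f` factors through `x`, and a shear absorbs it into `g`. -/
theorem ET4_5.et4_2 (H : P.ET4_5) : P.ET4_2 := by
  intro A B C D E x y δ f d e hx hd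
  obtain ⟨g, hg, hg'⟩ := P.realization _ _ _ _ _ _ f (𝟙 C) hx hd (by simp [IsMorphism, pull_id])
  obtain ⟨f₁, hf₁, -, hf₁'⟩ := H _ _ _ _ _ _ g hx hd (by simpa using hg'.symm)
  obtain ⟨w, hw⟩ := hx.exists_eq_fst_comp (a := f₁ - f) (by
    have := hf₁.ext
    rw [IsMorphism, pull_id] at this
    rw [P.sub_push, this, sub_self])
  have hs := hf₁'.shear w
  have : -f₁ + x ≫ w = -f := by rw [← hw]; abel
  rw [this] at hs
  refine ⟨g - w ≫ d, ⟨hx, hd, ?_, ?_, by simp [IsMorphism, pull_id]⟩, hs⟩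
  · rw [Preadditive.comp_sub, hg, ← Category.assoc, ← hw, Preadditive.sub_comp, ← hf₁.comm_left, hg]
    abel
  · rw [Preadditive.sub_comp, Category.assoc, hd.comp_eq_zero, comp_zero, sub_zero, hg']

theorem ET4_1.et4_2 (H : P.ET4_1) : P.ET4_2 := by
  intro A B C D E x y δ f d e hx hd
  obtain ⟨M, m₁, e₁, m₂, e₂, h₁, h₂, h₃, h₄, h₅, h₆⟩ := H _ _ _ _ _ _ hx hd
  -- The extension `y^* f_* δ = f_* y^* δ` vanishes, so `M` is `D ⊞ B`.
  rw [← push_pull, hx.pull_eq_zero, push_zero] at h₅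
  obtain ⟨b, hb, hb'⟩ := h₅.exists_iso (P.isTriangle_inl_snd D B)
  have hm₁ : m₁ ≫ b.hom = biprod.lift (m₁ ≫ b.hom ≫ biprod.fst) x := by
    apply biprod.hom_ext
    · simp
    · simp [hb', h₂]
  have he₁ : b.inv ≫ e₁ = biprod.desc d (biprod.inr ≫ b.inv ≫ e₁) := by
    apply biprod.hom_ext'
    · rw [biprod.inl_desc, ← hb, Category.assoc, b.hom_inv_id_assoc, h₁]
    · simp
  have hT := h₄.mid_iso b hm₁ (y' := b.inv ≫ e₁) (by simp)
  rw [he₁] at hT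
  -- Projecting `m₁_* δ + m₂_* f_* δ = 0` to `D` shows that the `D`-component of `m₁` agrees with
  -- `-f` up to a map through `x`; the shear removes the error.
  obtain ⟨w, hw⟩ := hx.exists_eq_fst_comp (a := f + m₁ ≫ b.hom ≫ biprod.fst) (by
    have := congrArg (push (b.hom ≫ biprod.fst)) h₆
    rw [push_add, push_push, push_push, reassoc_of% hb, biprod.inl_fst, push_id, push_zero] at this
    rw [P.add_push, add_comm, this])
  have hs := hT.shear (-w)
  have hf : m₁ ≫ b.hom ≫ biprod.fst + x ≫ (-w) = -f := by
    rw [Preadditive.comp_neg, ← hw]; abel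
  rw [hf] at hs
  refine ⟨_, ⟨hx, hd, ?_, ?_, by simp [IsMorphism, pull_id]⟩, hs⟩
  · have := hs.comp_eq_zero
    rw [biprod.lift_desc, Preadditive.neg_comp, neg_add_eq_zero] at this
    exact this.symm
  · have hy : e₁ ≫ e = b.hom ≫ biprod.snd ≫ y := by rw [h₃, ← hb', Category.assoc]
    simp [hd.comp_eq_zero, hy]

/-- (ET4-4) is applied to the graph `(g, 𝟙) : B₁ ⟶ B₂ ⊞ B₁` and the deflation `B₂ ⊞ B₁ ⟶ B₂ ⟶ C`,
whose cocone is `A₂ ⊞ B₁`; the composite is `y₁`. -/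
theorem ET4_4.et4_5 (H : P.ET4_4) : P.ET4_5 := by
  intro A₁ B₁ A₂ B₂ C x₁ y₁ δ x₂ y₂ δ' g h₁ h₂ hg
  have hG : P.IsTriangle (biprod.lift g (𝟙 B₁)) (biprod.desc (𝟙 B₂) (-g)) 0 := by
    simpa using P.isTriangle_lift_desc (-g)
  have hh : P.IsTriangle (biprod.map x₂ (𝟙 B₁)) (biprod.fst ≫ y₂) (push biprod.inl δ') := by
    refine IsTriangle.right_iso
      (P.realization_sum _ _ _ _ _ _ h₂ (P.isTriangle_id_zero B₁))
      ⟨biprod.inl, biprod.fst, ?_, ?_⟩ ?_ ?_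
    · simp
    · apply biprod.hom_ext
      · simp
      · exact (isZero_zero 𝒞).eq_of_tgt _ _
    · apply biprod.hom_ext
      · simp
      · exact (isZero_zero 𝒞).eq_of_tgt _ _
    · simp [EExt.sum, ← push_pull, pull_pull, pull_zero, push_zero, pull_id]
  obtain ⟨u, v, θ, h₃, h₄, rfl, h₆, h₇, h₈⟩ := H _ _ _ _ _ _ _ _ _ h₁ hG hh (by simp [hg])
  have hu : (u ≫ biprod.fst) ≫ x₂ = x₁ ≫ g := by
    simpa using (congrArg (· ≫ biprod.fst) h₄).symm
  have hu' : u ≫ biprod.snd = x₁ := by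
    simpa using (congrArg (· ≫ biprod.snd) h₄).symm
  have hδ : push (u ≫ biprod.fst) δ = δ' := by
    rw [← push_push, h₆, push_push, biprod.inl_fst, push_id]
  have hθ : -θ = pull y₂ δ := by
    have := congrArg (pull biprod.inl) h₈
    rw [pull_add, pull_pull, pull_pull, biprod.inl_desc, pull_id, biprod.inl_fst_assoc,
      pull_zero] at this
    exact neg_eq_of_add_eq_zero_right this
  refine ⟨u ≫ biprod.fst, ⟨h₁, h₂, hu.symm, by simp [hg], ?_⟩, hu.symm, ?_⟩
  · rw [IsMorphism, hδ, pull_id]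
  -- The triangle obtained is `(f, x₁)`, `(x₂, -g)`, `θ = -y₂^* δ`. The sign change on `A₂` followed
  -- by `neg_right` brings all signs to the required form.
  · have := (h₃.mid_iso (⟨biprod.map (-𝟙 A₂) (𝟙 B₁), biprod.map (-𝟙 A₂) (𝟙 B₁), ?_, ?_⟩ :
      A₂ ⊞ B₁ ≅ A₂ ⊞ B₁) (x' := biprod.lift (-(u ≫ biprod.fst)) x₁) (y' := biprod.desc (-x₂) (-g))
      ?_ ?_).neg_right
    · rw [hθ] at this
      convert this using 1
      apply biprod.hom_ext' <;> simp
    · apply biprod.hom_ext' <;> apply biprod.hom_ext <;> simp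
    · apply biprod.hom_ext' <;> apply biprod.hom_ext <;> simp
    · apply biprod.hom_ext <;> simp [hu']
    · apply biprod.hom_ext' <;> simp

/-- The cone `G` of `f ≫ g` splits as `C ⊞ F`, in such a way that `p : B ⟶ G` has components `h'`
and `g'`. Then (ET4)ᵒᵖ for `p` and the projection `r : G ⟶ C` compares the cocones of `p` and of `p
≫ r = h'`. The extension `θ` is the restriction of `ε` to `F`. -/
theorem ET4.et4_4 (H : P.ET4) (H' : P.ET4op) : P.ET4_4 := by
  intro A B C D E F f f' δf g g' δg h h' δh hf hg hh e
  obtain ⟨G, _, p, ε, i, q, rfl, h₁, h₂, h₃, h₄, h₅, h₆⟩ := H _ _ _ _ _ _ hf hg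
  rw [← e, ← push_push, hg.push_eq_zero, push_zero] at h₄
  obtain ⟨r₁, hr₁⟩ := h₄.exists_eq_fst_comp (a := 𝟙 C) (push_zero _)
  -- An arbitrary retraction `r₁` of `i` need not satisfy `p ≫ r₁ = h'`, but the error factors
  -- through `g' = p ≫ q`, so `r₁ - q ≫ t` does, and it is still a retraction.
  obtain ⟨t, ht⟩ := hg.exists_eq_snd_comp (m := p ≫ r₁ - h') (by
    rw [Preadditive.comp_sub, ← Category.assoc, ← h₁, Category.assoc, ← hr₁, e, Category.comp_id,
      sub_self])
  have hpr : p ≫ (r₁ - q ≫ t) = h' := by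
    rw [Preadditive.comp_sub, ← Category.assoc, h₂, ← ht]; abel
  have hir : i ≫ (r₁ - q ≫ t) = 𝟙 C := by
    rw [Preadditive.comp_sub, ← Category.assoc, h₄.comp_eq_zero, zero_comp, sub_zero, ← hr₁]
  generalize r₁ - q ≫ t = r at hpr hir
  obtain ⟨j, hjq, hjr, hri⟩ := h₄.exists_section hir
  have hj : P.IsTriangle j r 0 :=
    P.isTriangle_of_splitting hjq hir hjr h₄.comp_eq_zero (by rw [add_comm, hri])
  obtain ⟨E', k, l, ζ, d, c, h₇, h₈, h₉, h₁₀, h₁₁, -, h₁₃⟩ := H' _ _ _ _ _ _ h₃ hj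
  subst hpr
  subst h₉
  obtain ⟨a, ha, ha'⟩ := h₁₁.exists_iso_left hh
  have hd : push (d ≫ a.hom) ε = pull r δh := by
    rw [← push_push, h₁₃, push_pull, ha']
  refine ⟨d ≫ a.hom, a.inv ≫ c, pull j ε, h₁₀.mid_iso a rfl (by simp), ?_, ?_, ?_, ?_, ?_⟩
  · rw [Category.assoc, ha, h₇]
  · rw [Iso.eq_inv_comp, ← Category.assoc, ha, ← h₂, ← Category.assoc, h₈, Category.assoc, hjq,
      Category.comp_id]
  · rw [← h₅, push_pull, hd, pull_pull, hir, pull_id]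
  · rw [push_pull, h₆, pull_pull, hjq, pull_id]
  -- By the splitting of `G` the sum is `p^* ε`, which is zero.
  · rw [← h₅, ← h₂, pull_pull, pull_pull, ← P.add_pull]
    have : (p ≫ q) ≫ j + (p ≫ r) ≫ i = p := by
      rw [Category.assoc, Category.assoc, ← Preadditive.comp_add, add_comm, hri, Category.comp_id]
    rw [this, h₃.pull_eq_zero]

/-- The dual of (ET4-2). -/
def ET4_2op (P : PreExtriangulated.{w} 𝒞) : Prop :=
  ∀ ⦃A B C D E : 𝒞⦄ (x : A ⟶ B) (y : B ⟶ C) (δ : EExt P.E C A) (c : D ⟶ C)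
    (d : A ⟶ E) (e : E ⟶ D),
    P.IsTriangle x y δ → P.IsTriangle d e (EExt.pull c δ) →
    ∃ g : E ⟶ B, P.IsTriangleMorphism d e (EExt.pull c δ) x y δ (𝟙 A) g c ∧
      P.IsTriangle (biprod.lift e g) (biprod.desc (-c) y) (EExt.push d δ)

/-- Realizations `M` of `y₂^* δ₁` and `N` of `y₁^* δ₂` are both cocones of `(-y₂, y₁) : B₂ ⊞ B₁ ⟶
C`, the second after a swap and a sign. Hence `M ≅ N`, and that sign is the reason for `m₁_* δ₁ +
m₂_* δ₂ = 0`. -/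
theorem ET4_2op.et4_1 (H : P.ET4_2op) : P.ET4_1 := by
  intro A₁ B₁ A₂ B₂ C x₁ y₁ δ₁ x₂ y₂ δ₂ h₁ h₂
  obtain ⟨M, m₁, e₁, hM⟩ := P.exists_isTriangle (pull y₂ δ₁)
  obtain ⟨N, m₂, e₂, hN⟩ := P.exists_isTriangle (pull y₁ δ₂)
  obtain ⟨g, hg, hT⟩ := H _ _ _ y₂ m₁ e₁ h₁ hM
  obtain ⟨k, hk, hS⟩ := H _ _ _ y₁ m₂ e₂ h₂ hN
  have hS' : P.IsTriangle (biprod.lift k e₂) (biprod.desc (-y₂) y₁) (-push m₂ δ₂) :=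
    hS.neg_right.mid_iso (biprod.braiding _ _) (by apply biprod.hom_ext <;> simp)
      (by apply biprod.hom_ext' <;> simp)
  obtain ⟨a, ha, ha'⟩ := hT.exists_iso_left hS'
  have hak : a.hom ≫ k = e₁ := by simpa using congrArg (· ≫ biprod.fst) ha
  have hae : a.hom ≫ e₂ = g := by simpa using congrArg (· ≫ biprod.snd) ha
  refine ⟨M, m₁, e₁, m₂ ≫ a.inv, g, ?_, ?_, hg.comm_right, hM, hN.mid_iso a.symm rfl ?_, ?_⟩
  · rw [← hak]
    simpa using hk.comm_left
  · simpa using hg.comm_left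
  · rw [← hae]; simp
  · have := congrArg (push a.inv) ha'
    rw [push_push, push_push, push_neg, push_push, ← Category.assoc, Category.assoc, a.hom_inv_id,
      Category.comp_id] at this
    rw [this, neg_add_cancel]

/-! ### Passage to the opposite category and conclusion. -/

/-- The biproduct chosen in `𝒞ᵒᵖ` is only isomorphic to that of `𝒞`, so the middle term is
transported along `unopBiprodIso`. -/
theorem opposite_isTriangle_lift_desc_iff (P : PreExtriangulated.{w} 𝒞) {A B C D : 𝒞ᵒᵖ}
    (p : A ⟶ D) (x : A ⟶ B) (d : D ⟶ C) (g : B ⟶ C) (δ : EExt P.opposite.E C A) :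
    P.opposite.IsTriangle (biprod.lift p x) (biprod.desc d g) δ ↔
      P.IsTriangle (A := C.unop) (C := A.unop) (biprod.lift d.unop g.unop)
        (biprod.desc p.unop x.unop) δ := by
  have h₁ : biprod.lift d.unop g.unop ≫ (unopBiprodIso D B).hom = (biprod.desc d g).unop := by
    rw [← cancel_mono (unopBiprodIso D B).inv]
    apply biprod.hom_ext <;> simp [unopBiprodIso, ← unop_comp]
  have h₂ : (unopBiprodIso D B).hom ≫ (biprod.lift p x).unop = biprod.desc p.unop x.unop := by
    apply biprod.hom_ext' <;> simp [unopBiprodIso, ← unop_comp]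
  rw [opposite_isTriangle_iff]
  constructor
  · intro h
    exact h.mid_iso (unopBiprodIso D B).symm (by simp [← h₁]) (by simp [← h₂])
  · intro h
    exact h.mid_iso (unopBiprodIso D B) h₁ h₂

theorem opposite_ET4_2_iff (P : PreExtriangulated.{w} 𝒞) : P.opposite.ET4_2 ↔ P.ET4_2op := by
  constructor
  · intro H A B C D E x y δ c d e h h'
    obtain ⟨g, hg, hg'⟩ := H (A := op C) (B := op B) (C := op A) (D := op D) (E := op E)
      y.op x.op δ c.op e.op d.op ((P.opposite_isTriangle_iff _ _ _).2 h)
      ((P.opposite_isTriangle_iff _ _ _).2 h')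
    exact ⟨g.unop, ⟨h', h, (congrArg Quiver.Hom.unop hg.comm_right).symm,
      (congrArg Quiver.Hom.unop hg.comm_left).symm, push_id _⟩,
      (P.opposite_isTriangle_lift_desc_iff _ _ _ _ _).1 hg'⟩
  · intro H A B C D E x y δ f d e h h'
    obtain ⟨g, hg, hg'⟩ := H (A := C.unop) (B := B.unop) (C := A.unop) (D := D.unop) (E := E.unop)
      y.unop x.unop δ f.unop e.unop d.unop ((P.opposite_isTriangle_iff _ _ _).1 h)
      ((P.opposite_isTriangle_iff _ _ _).1 h')
    exact ⟨g.op, ⟨h, h', Quiver.Hom.unop_inj hg.comm_right.symm,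
      Quiver.Hom.unop_inj hg.comm_left.symm, (pull_id _).symm⟩,
      (P.opposite_isTriangle_lift_desc_iff _ _ _ _ _).2 hg'⟩

theorem opposite_ET4_2op_iff (P : PreExtriangulated.{w} 𝒞) : P.opposite.ET4_2op ↔ P.ET4_2 := by
  constructor
  · intro H A B C D E x y δ f d e h h'
    obtain ⟨g, hg, hg'⟩ := H (A := op C) (B := op B) (C := op A) (D := op D) (E := op E)
      y.op x.op δ f.op e.op d.op ((P.opposite_isTriangle_iff _ _ _).2 h)
      ((P.opposite_isTriangle_iff _ _ _).2 h')
    exact ⟨g.unop, ⟨h, h', (congrArg Quiver.Hom.unop hg.comm_right).symm,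
      (congrArg Quiver.Hom.unop hg.comm_left).symm, (pull_id _).symm⟩,
      (P.opposite_isTriangle_lift_desc_iff _ _ _ _ _).1 hg'⟩
  · intro H A B C D E x y δ c d e h h'
    obtain ⟨g, hg, hg'⟩ := H (A := C.unop) (B := B.unop) (C := A.unop) (D := D.unop) (E := E.unop)
      y.unop x.unop δ c.unop e.unop d.unop ((P.opposite_isTriangle_iff _ _ _).1 h)
      ((P.opposite_isTriangle_iff _ _ _).1 h')
    exact ⟨g.op, ⟨h', h, Quiver.Hom.unop_inj hg.comm_right.symm,
      Quiver.Hom.unop_inj hg.comm_left.symm, push_id _⟩,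
      (P.opposite_isTriangle_lift_desc_iff _ _ _ _ _).2 hg'⟩

theorem opposite_inflation_iff (P : PreExtriangulated.{w} 𝒞) {A B : 𝒞ᵒᵖ} (f : A ⟶ B) :
    P.opposite.Inflation f ↔ P.Deflation f.unop := by
  constructor
  · rintro ⟨C, y, δ, h⟩
    exact ⟨C.unop, y.unop, δ, (P.opposite_isTriangle_iff _ _ _).1 h⟩
  · rintro ⟨C, y, δ, h⟩
    exact ⟨op C, y.op, δ, (P.opposite_isTriangle_iff _ _ _).2 h⟩

theorem opposite_deflation_iff (P : PreExtriangulated.{w} 𝒞) {A B : 𝒞ᵒᵖ} (f : A ⟶ B) :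
    P.opposite.Deflation f ↔ P.Inflation f.unop := by
  constructor
  · rintro ⟨C, y, δ, h⟩
    exact ⟨C.unop, y.unop, δ, (P.opposite_isTriangle_iff _ _ _).1 h⟩
  · rintro ⟨C, y, δ, h⟩
    exact ⟨op C, y.op, δ, (P.opposite_isTriangle_iff _ _ _).2 h⟩

theorem ET0.opposite (h : P.ET0) : P.opposite.ET0op := by
  intro A B C f g hf hg
  rw [opposite_deflation_iff] at hf hg ⊢
  exact h _ _ hg hf

theorem ET0op.opposite (h : P.ET0op) : P.opposite.ET0 := by
  intro A B C f g hf hg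
  rw [opposite_inflation_iff] at hf hg ⊢
  exact h _ _ hg hf

theorem ET4_2.opposite_et4_1 (H : P.ET4_2) : P.opposite.ET4_1 :=
  (P.opposite_ET4_2op_iff.2 H).et4_1

/-- Each direction is the chain from the dual of (ET4-2) through (ET4-1) to (ET4-2), run in the
opposite category or in `𝒞`. -/
theorem ET4_2_iff_opposite_ET4_2 (P : PreExtriangulated.{w} 𝒞) :
    P.ET4_2 ↔ P.opposite.ET4_2 :=
  ⟨fun H => H.opposite_et4_1.et4_2, fun H => (P.opposite_ET4_2_iff.1 H).et4_1.et4_2⟩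

theorem ET4_2.et4_1 (H : P.ET4_2) : P.ET4_1 :=
  (P.opposite_ET4_2_iff.1 (P.ET4_2_iff_opposite_ET4_2.1 H)).et4_1

theorem ET4_2.et4 (h : P.ET0) (H : P.ET4_2) : P.ET4 :=
  H.et4_3.et4 h

theorem ET4.et4_2 (h : P.ET0) (H : P.ET4) : P.ET4_2 :=
  H.et4_3.et4_2 h

theorem ET4_2.et4_4 (h : P.ET0) (h' : P.ET0op) (H : P.ET4_2) : P.ET4_4 :=
  (H.et4 h).et4_4 (P.opposite_ET4_iff.1 ((P.ET4_2_iff_opposite_ET4_2.1 H).et4 h'.opposite))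

theorem tfae_ET4 (P : PreExtriangulated.{w} 𝒞) (h : P.ET0) (h' : P.ET0op) :
    List.TFAE [P.ET4, P.ET4_1, P.ET4_2, P.ET4_3, P.ET4_4, P.ET4_5] := by
  tfae_have 1 → 3 := fun H => H.et4_2 h
  tfae_have 3 → 1 := fun H => H.et4 h
  tfae_have 2 → 3 := fun H => H.et4_2
  tfae_have 3 → 2 := fun H => H.et4_1
  tfae_have 3 → 4 := fun H => H.et4_3
  tfae_have 4 → 3 := fun H => H.et4_2 h
  tfae_have 3 → 5 := fun H => H.et4_4 h h'
  tfae_have 5 → 6 := fun H => H.et4_5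
  tfae_have 6 → 3 := fun H => H.et4_2
  tfae_finish

end PreExtriangulated

theorem theorem3p7 {𝒞 : Type u} [Category.{v} 𝒞] [Preadditive 𝒞] [HasZeroObject 𝒞]
    [HasBinaryBiproducts 𝒞] (P : PreExtriangulated.{w} 𝒞) (h : P.ET0) (h' : P.ET0op) :
    List.TFAE [P.ET4, P.ET4_1, P.ET4_2, P.ET4_3, P.ET4_4, P.ET4_5] ∧
      (P.ET4 ↔ P.opposite.ET4) ∧ (P.ET4_1 ↔ P.opposite.ET4_1) ∧
      (P.ET4_2 ↔ P.opposite.ET4_2) ∧ (P.ET4_3 ↔ P.opposite.ET4_3) ∧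
      (P.ET4_4 ↔ P.opposite.ET4_4) ∧ (P.ET4_5 ↔ P.opposite.ET4_5) := by
  have T := P.tfae_ET4 h h'
  -- Passing to the opposite exchanges (ET0) and (ET0)ᵒᵖ, so the equivalences hold there too, and
  -- self-duality of (ET4-2) spreads to the other conditions.
  have T' := P.opposite.tfae_ET4 h'.opposite h.opposite
  have key := P.ET4_2_iff_opposite_ET4_2
  exact ⟨T, ((T.out 0 2).trans key).trans (T'.out 2 0), ((T.out 1 2).trans key).trans (T'.out 2 1),
    key, ((T.out 3 2).trans key).trans (T'.out 2 3), ((T.out 4 2).trans key).trans (T'.out 2 4),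
    ((T.out 5 2).trans key).trans (T'.out 2 5)⟩
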